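/- **Theorem 2.1.** Let $(b_n)_{n\ge 1}$ be real numbers with $b_n\le b_{n+1}<0$ for all $n\ge1$ and $b_n\to0$. Let $J$ be the Jacobi matrix with off-diagonal entries $a_n\equiv 1$ and diagonal entries $b_1,b_2,\dots$, regarded as a bounded self-adjoint operator on $\ell^2(\{0,1,2,\dots\})$, and let $\mu$ be its spectral measure for $\delta_0=(1,0,0,\dots)$, that is, $\int f\,d\mu=\langle\delta_0,f(J)\delta_0\rangle$ for all continuous compactly supported $f$. For $x\in(0,2)$ let $N(x)\ge 0$ be the integer with $x-b_n\ge2$ for $1\le n\le N(x)$ and $x-b_n<2$ for $n>N(x)$ (the turning point). For $1\le n\le N(x)$ let $\gamma_n(x)\ge0$ be defined by $x-b_n=2\cosh\gamma_n(x)$, and put $g(x)=\sum_{j=1}^{N(x)}\gamma_j(x)$. Then $\mu$ is purely absolutely continuous on $(-2,2)$, and $d\mu=w(x)\,dx$ there with $w$ continuous and strictly positive on $(-2,2)$. There are constants $C_1,C_2>0$ (which may depend on the sequence $(b_n)$, but not on $x$) such that $$C_1(x+2)\le w(x)\le C_2(x+2)^{-1}\qquad\text{for }x\in(-2,0].$$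 Moreover, on $(0,2)$ one has $w(x)=e^{-2Q(x)}$ with $$|Q(x)-g(x)|\le h(x),\qquad e^{h(x)}=C\,\max(N(x),1)\,\bigl(b_{N(x)+2}-b_{N(x)+1}\bigr)^{-1}(2-x)^{1/2},$$ where $C>0$ is a constant that depends only on $\sup_n|b_n|$ and not on $x$. If $b_{N(x)+2}=b_{N(x)+1}$, then $h(x)=+\infty$ and the bound says nothing. Here $\max(N(x),1)=N(x)$ for all $x$ near $2$, namely for $2+b_1\le x<2$. -/

import Mathlib

open MeasureTheory Filter Topology Set
open scoped CompactlySupported InnerProductSpace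

noncomputable section

/-- The Hilbert space `ℓ²(ℕ)` of square-summable complex sequences `(u 0, u 1, …)`. -/
abbrev EllTwo : Type := lp (fun _ : ℕ => ℂ) 2

/-- Bounded Jacobi parameters `{a n, b n}` for `n ≥ 1`: `a n > 0`, `b n` real, both sequences
bounded. The values `a 0` and `b 0` are never used. -/
structure JacobiParameters where
  a : ℕ → ℝ
  b : ℕ → ℝ
  a_pos : ∀ n, 1 ≤ n → 0 < a n
  a_bounded : ∃ M : ℝ, ∀ n, 1 ≤ n → |a n| ≤ M
  b_bounded : ∃ M : ℝ, ∀ n, 1 ≤ n → |b n| ≤ M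

namespace JacobiParameters

variable (P : JacobiParameters)

/-- The action of the Jacobi matrix with diagonal `b 1, b 2, …` and off-diagonal `a 1, a 2, …`
on a sequence `u = (u 0, u 1, …)`:
`(J u) n = a (n+1) * u (n+1) + b (n+1) * u n + a n * u (n-1)`, with no last term for `n = 0`. -/
def jacobiFun (u : ℕ → ℂ) : ℕ → ℂ
  | 0 => (P.a 1 : ℂ) * u 1 + (P.b 1 : ℂ) * u 0
  | n + 1 => (P.a (n + 2) : ℂ) * u (n + 2) + (P.b (n + 2) : ℂ) * u (n + 1) + (P.a (n + 1) : ℂ) * u n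

theorem memlp_two_iff (u : ℕ → ℂ) : Memℓp u 2 ↔ Summable fun n => ‖u n‖ ^ 2 := by
  rw [memℓp_gen_iff (by norm_num)]
  simp

theorem memlp_diag {c : ℕ → ℝ} {M : ℝ} (hc : ∀ n, |c n| ≤ M) {u : ℕ → ℂ} (hu : Memℓp u 2) :
    Memℓp (fun n => (c n : ℂ) * u n) 2 := by
  rw [memlp_two_iff] at hu ⊢
  refine Summable.of_nonneg_of_le (fun n => by positivity) (fun n => ?_) (hu.mul_left (M ^ 2))
  rw [norm_mul, mul_pow, Complex.norm_real, Real.norm_eq_abs]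
  gcongr
  exact hc n

theorem memlp_shift {u : ℕ → ℂ} (hu : Memℓp u 2) : Memℓp (fun n => u (n + 1)) 2 := by
  rw [memlp_two_iff] at hu ⊢
  exact (summable_nat_add_iff 1).2 hu

theorem memlp_unshift {u : ℕ → ℂ} (hu : Memℓp (fun n => u (n + 1)) 2) : Memℓp u 2 := by
  rw [memlp_two_iff] at hu ⊢
  exact (summable_nat_add_iff 1).1 hu

/-- The off-diagonal part below the diagonal. -/
def lowerFun (u : ℕ → ℂ) : ℕ → ℂ
  | 0 => 0
  | n + 1 => (P.a (n + 1) : ℂ) * u n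

theorem jacobiFun_eq (u : ℕ → ℂ) : P.jacobiFun u =
    (fun n => (P.a (n + 1) : ℂ) * u (n + 1)) + (fun n => (P.b (n + 1) : ℂ) * u n) +
      P.lowerFun u := by
  funext n
  cases n <;> simp [jacobiFun, lowerFun]

theorem memlp_upper {u : ℕ → ℂ} (hu : Memℓp u 2) :
    Memℓp (fun n => (P.a (n + 1) : ℂ) * u (n + 1)) 2 := by
  obtain ⟨M, hM⟩ := P.a_bounded
  exact memlp_diag (c := fun n => P.a (n + 1)) (fun n => hM (n + 1) (by omega)) (memlp_shift hu)

theorem memlp_mid {u : ℕ → ℂ} (hu : Memℓp u 2) : Memℓp (fun n => (P.b (n + 1) : ℂ) * u n) 2 := by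
  obtain ⟨M, hM⟩ := P.b_bounded
  exact memlp_diag (c := fun n => P.b (n + 1)) (fun n => hM (n + 1) (by omega)) hu

theorem memlp_lower {u : ℕ → ℂ} (hu : Memℓp u 2) : Memℓp (P.lowerFun u) 2 := by
  obtain ⟨M, hM⟩ := P.a_bounded
  exact memlp_unshift
    (memlp_diag (c := fun n => P.a (n + 1)) (fun n => hM (n + 1) (by omega)) hu)

theorem memlp_jacobiFun {u : ℕ → ℂ} (hu : Memℓp u 2) : Memℓp (P.jacobiFun u) 2 := by
  rw [jacobiFun_eq]
  exact ((P.memlp_upper hu).add (P.memlp_mid hu)).add (P.memlp_lower hu)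

/-- The Jacobi matrix as a linear map of `ℓ²(ℕ)`. -/
def jacobiLinearMap : EllTwo →ₗ[ℂ] EllTwo where
  toFun u := ⟨P.jacobiFun u, P.memlp_jacobiFun (lp.memℓp u)⟩
  map_add' u v := by
    ext n
    change P.jacobiFun (⇑u + ⇑v) n = P.jacobiFun u n + P.jacobiFun v n
    cases n <;> simp [jacobiFun] <;> ring
  map_smul' c u := by
    ext n
    change P.jacobiFun (c • ⇑u) n = c * P.jacobiFun u n
    cases n <;> simp [jacobiFun] <;> ring

theorem jacobiLinearMap_isSymmetric : P.jacobiLinearMap.IsSymmetric := by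
  intro u v
  have hu := lp.memℓp u
  have hv := lp.memℓp v
  have e1 : ∀ w : EllTwo, P.jacobiLinearMap w =
      (⟨_, P.memlp_upper (lp.memℓp w)⟩ : EllTwo) + ⟨_, P.memlp_mid (lp.memℓp w)⟩ +
        ⟨_, P.memlp_lower (lp.memℓp w)⟩ := by
    intro w
    ext n
    exact congrFun (P.jacobiFun_eq w) n
  have e2 : ∀ w z : EllTwo, ⟪(⟨_, P.memlp_upper (lp.memℓp w)⟩ : EllTwo), z⟫_ℂ =
      ⟪w, (⟨_, P.memlp_lower (lp.memℓp z)⟩ : EllTwo)⟫_ℂ := by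
    intro w z
    have s := lp.summable_inner (𝕜 := ℂ) w (⟨_, P.memlp_lower (lp.memℓp z)⟩ : EllTwo)
    rw [lp.inner_eq_tsum, lp.inner_eq_tsum, s.tsum_eq_zero_add]
    simp [lowerFun, mul_left_comm, mul_assoc]
  have e3 : ⟪(⟨_, P.memlp_mid (lp.memℓp u)⟩ : EllTwo), v⟫_ℂ =
      ⟪u, (⟨_, P.memlp_mid (lp.memℓp v)⟩ : EllTwo)⟫_ℂ := by
    rw [lp.inner_eq_tsum, lp.inner_eq_tsum]
    simp [mul_left_comm, mul_assoc]
  have e4 : ⟪(⟨_, P.memlp_lower (lp.memℓp u)⟩ : EllTwo), v⟫_ℂ =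
      ⟪u, (⟨_, P.memlp_upper (lp.memℓp v)⟩ : EllTwo)⟫_ℂ := by
    rw [← inner_conj_symm, ← e2 v u, inner_conj_symm]
  rw [e1 u, e1 v]
  simp only [inner_add_left, inner_add_right]
  rw [e2, e3, e4]
  ring

/-- The Jacobi matrix as a bounded operator on `ℓ²(ℕ)` (an everywhere defined symmetric operator
is continuous). -/
def jacobiOperator : EllTwo →L[ℂ] EllTwo :=
  (P.jacobiLinearMap_isSymmetric.toSelfAdjoint : EllTwo →L[ℂ] EllTwo)

theorem jacobiOperator_isSelfAdjoint : IsSelfAdjoint P.jacobiOperator :=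
  P.jacobiLinearMap_isSymmetric.toSelfAdjoint.2

theorem jacobiOperator_apply (u : EllTwo) (n : ℕ) :
    P.jacobiOperator u n = P.jacobiFun u n := rfl

end JacobiParameters

/-- The first basis vector `δ₀ = (1, 0, 0, …)` of `ℓ²(ℕ)`. -/
def deltaZero : EllTwo := lp.single 2 0 (1 : ℂ)

/-- For a self-adjoint bounded operator `T` and a vector `v`, the positive linear functional
`f ↦ ⟨v, f(T) v⟩` on `C_c(ℝ)`, where `f(T)` is given by the continuous functional calculus. -/
def spectralFunctional {H : Type*} [NormedAddCommGroup H] [InnerProductSpace ℂ H]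
    [CompleteSpace H] (T : H →L[ℂ] H) (_hT : IsSelfAdjoint T) (v : H) :
    C_c(ℝ, ℝ) →ₚ[ℝ] ℝ :=
  PositiveLinearMap.mk₀
    { toFun := fun f => (⟪v, cfc (f : ℝ → ℝ) T v⟫_ℂ).re
      map_add' := fun f g => by
        have h : cfc (⇑(f + g) : ℝ → ℝ) T = cfc (f : ℝ → ℝ) T + cfc (g : ℝ → ℝ) T := by
          rw [← cfc_add (a := T) (f : ℝ → ℝ) (g : ℝ → ℝ) f.continuous.continuousOn
            g.continuous.continuousOn]
          rfl
        rw [h]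
        simp
      map_smul' := fun c f => by
        have h : cfc (⇑(c • f) : ℝ → ℝ) T = c • cfc (f : ℝ → ℝ) T := by
          rw [← cfc_smul (a := T) c (f : ℝ → ℝ) f.continuous.continuousOn]
          rfl
        rw [h]
        simp }
    (fun f hf => by
      have h : 0 ≤ cfc (f : ℝ → ℝ) T := cfc_nonneg (fun x _ => hf x)
      exact ((ContinuousLinearMap.nonneg_iff_isPositive _).1 h).re_inner_nonneg_right v)

/-- The spectral measure of the self-adjoint bounded operator `T` and the vector `v`: the unique
Radon measure `μ` on `ℝ` with `∫ f dμ = ⟨v, f(T) v⟩` for all `f ∈ C_c(ℝ)`. -/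
def spectralMeasure {H : Type*} [NormedAddCommGroup H] [InnerProductSpace ℂ H]
    [CompleteSpace H] (T : H →L[ℂ] H) (hT : IsSelfAdjoint T) (v : H) : Measure ℝ :=
  RealRMK.rieszMeasure (spectralFunctional T hT v)

theorem integral_spectralMeasure {H : Type*} [NormedAddCommGroup H] [InnerProductSpace ℂ H]
    [CompleteSpace H] (T : H →L[ℂ] H) (hT : IsSelfAdjoint T) (v : H) (f : C_c(ℝ, ℝ)) :
    ∫ x, f x ∂(spectralMeasure T hT v) = (⟪v, cfc (f : ℝ → ℝ) T v⟫_ℂ).re :=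
  RealRMK.integral_rieszMeasure _ f

/-- The spectral measure of a Jacobi matrix: that of its operator on `ℓ²(ℕ)` and `δ₀`. -/
def JacobiParameters.measure (P : JacobiParameters) : Measure ℝ :=
  spectralMeasure P.jacobiOperator P.jacobiOperator_isSelfAdjoint deltaZero

/-- The turning point `N(x)`: the largest `n ≥ 1` with `x - b n ≥ 2`, and `0` if there is none. -/
def turningPoint (b : ℕ → ℝ) (x : ℝ) : ℕ := sSup {n : ℕ | 1 ≤ n ∧ 2 ≤ x - b n}

/-- For increasing `b n → 0` and `x < 2`, the turning point is the integer `N` with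
`x - b n ≥ 2` for `n ≤ N` and `x - b n < 2` for `n > N`. -/
theorem turningPoint_spec {b : ℕ → ℝ} (hmono : ∀ n, 1 ≤ n → b n ≤ b (n + 1))
    (hlim : Tendsto b atTop (𝓝 0)) {x : ℝ} (hx : x < 2) :
    (∀ n, 1 ≤ n → n ≤ turningPoint b x → 2 ≤ x - b n) ∧
      (∀ n, turningPoint b x < n → x - b n < 2) := by
  have hbdd : BddAbove {n : ℕ | 1 ≤ n ∧ 2 ≤ x - b n} := by
    obtain ⟨K, hK⟩ := eventually_atTop.1 (hlim.eventually (lt_mem_nhds (sub_neg.2 hx)))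
    refine ⟨K, fun n hn => ?_⟩
    by_contra! h
    have h1 := hK n h.le
    have h2 := hn.2
    linarith
  constructor
  · intro n hn hnN
    have hne : {n : ℕ | 1 ≤ n ∧ 2 ≤ x - b n}.Nonempty := by
      by_contra h
      rw [Set.not_nonempty_iff_eq_empty] at h
      rw [turningPoint, h, csSup_empty] at hnN
      simp at hnN
      omega
    have h1 : 2 ≤ x - b (turningPoint b x) := (Nat.sSup_mem hne hbdd).2
    have h2 : b n ≤ b (turningPoint b x) :=
      Nat.le_induction (m := n) (P := fun k _ => b n ≤ b k) le_rfl
        (fun k hk ih => ih.trans (hmono k (hn.trans hk))) _ hnN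
    linarith
  · intro n hn
    by_contra! h
    exact absurd (le_csSup hbdd (show n ∈ {n : ℕ | 1 ≤ n ∧ 2 ≤ x - b n} from ⟨by omega, h⟩))
      (not_le.2 hn)

/-- `γ_n(x) ≥ 0` with `x - b n = 2 cosh γ_n(x)`, for `x - b n ≥ 2`. -/
def gammaExp (b : ℕ → ℝ) (n : ℕ) (x : ℝ) : ℝ := Real.arcosh ((x - b n) / 2)

theorem gammaExp_spec {b : ℕ → ℝ} {n : ℕ} {x : ℝ} (h : 2 ≤ x - b n) :
    0 ≤ gammaExp b n x ∧ x - b n = 2 * Real.cosh (gammaExp b n x) := by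
  have h1 : 1 ≤ (x - b n) / 2 := by linarith
  refine ⟨Real.arcosh_nonneg h1, ?_⟩
  rw [gammaExp, Real.cosh_arcosh h1]
  ring

/-- `g(x) = ∑_{j=1}^{N(x)} γ_j(x)`. -/
def gSum (b : ℕ → ℝ) (x : ℝ) : ℝ := ∑ j ∈ Finset.Icc 1 (turningPoint b x), gammaExp b j x

/-- The error bound `h(x)`, with
`e^{h(x)} = C * N(x) * (b_{N(x)+2} - b_{N(x)+1})⁻¹ * (2 - x)^{1/2}`, used only where
`b_{N(x)+1} < b_{N(x)+2}` (otherwise `h(x) = +∞`). The factor `N(x)` is read as `1`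
where `N(x) = 0`, that is, for `x < 2 + b 1`. -/
def hBound (C : ℝ) (b : ℕ → ℝ) (x : ℝ) : ℝ :=
  Real.log (C * (max (turningPoint b x) 1 : ℕ) *
    (b (turningPoint b x + 2) - b (turningPoint b x + 1))⁻¹ * Real.sqrt (2 - x))

end

/-!
For off-diagonal entries `1` the Turán determinants `S_n = p_n² - p_{n+1} p_{n-1}` of the
orthonormal polynomials satisfy `S_n - S_{n-1} = (b_{n+1} - b_n) p_n p_{n-1}` (`turan_succ`), and
`S_n` is a quadratic form in `(p_n, p_{n-1})` with middle coefficient `-(x - b_{n+1})`, hence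
positive definite as soon as `|x - b_{n+1}| < 2`. The increments are thus at most a summable
multiple of `S_n` itself, so `S_n` converges, locally uniformly on `(-2, 2)`, to a positive
continuous limit `S_∞` (`exists_turan_bounds`, `exists_abs_turanLim_sub_le`).

The weight is `w(x) = √(4 - x²) / (2π S_∞(x))` (`measure_restrict_eq_withDensity`). If the
diagonal vanishes beyond an index `N`, the resolvent matrix element `⟨δ₀, (J - z)⁻¹ δ₀⟩` is an
explicit function of `z` and of the root `ζ` of `ζ + 1/ζ = z` in the unit disc; it is continuous
up to the interval `(-2, 2)`, and its imaginary part there is found from a Wronskian. Stieltjes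
inversion (`tendsto_integral_spectralMeasure`) then gives the density. In general the diagonal is
truncated: since `b n → 0` the truncated operators converge in norm, so their spectral measures
converge vaguely, while their densities converge boundedly on compact subsets of `(-2, 2)`.

What remains is to estimate `S_∞` at the edges. With `s = x + 2`, near `-2` the ratio
`S_{n-1} / S_n` is at most `(s - b_n) / (s - b_{n+1})`, which telescopes to `S_∞ ≥ c s`; growth requires
`p_n p_{n-1} > 0`, in which case the relative growth is at most `b_{n+1} - b_n` for large `n`, so `S_∞`
is bounded. Near `2`, with `d = 2 - x` and `N` the turning point, the same two estimates beyond
`N`, with the roles of growth and decay exchanged, compare `S_∞` with `p_N²` up to constants and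
the factors `b_{N+2} - b_{N+1}` and `d` (`turanLim_bounds_upper_edge`). Up to the turning point
`x - b_n = 2 cosh γ_n` with decreasing `γ_n`, and `e^g ≤ p_N ≤ (N + 1) e^g`: the lower bound follows
from the recursion for `p_n / p_{n-1}`, the upper bound from the continued fraction read from the
other end, where the exponents increase along the recursion (`orthoPoly_le_exp_mul_shift`). The
resulting constant in the error bound is absolute.
-/

noncomputable section

/-! ### Stieltjes inversion for the spectral measure of a bounded self-adjoint operator -/

section StieltjesInversion

variable {H : Type*} [NormedAddCommGroup H] [InnerProductSpace ℂ H] [CompleteSpace H]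

/-- The Poisson kernel of the upper half-plane at `x + i ε`, without its factor `1 / π`. -/
def poissonKer (ε x t : ℝ) : ℝ := ε / ((x - t) ^ 2 + ε ^ 2)

theorem poissonKer_den_pos {ε : ℝ} (hε : 0 < ε) (x t : ℝ) : 0 < (x - t) ^ 2 + ε ^ 2 := by
  positivity

theorem continuous_poissonKer {ε : ℝ} (hε : 0 < ε) :
    Continuous fun q : ℝ × ℝ => poissonKer ε q.1 q.2 := by
  unfold poissonKer
  exact continuous_const.div (by fun_prop) fun q => (poissonKer_den_pos hε q.1 q.2).ne'

theorem abs_poissonKer_le {ε : ℝ} (hε : 0 < ε) (x t : ℝ) : |poissonKer ε x t| ≤ ε⁻¹ := by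
  have h := poissonKer_den_pos hε x t
  rw [poissonKer, abs_of_pos (by positivity), div_le_iff₀ h]
  have : ε⁻¹ * ((x - t) ^ 2 + ε ^ 2) = ε⁻¹ * (x - t) ^ 2 + ε := by
    field_simp
  rw [this]
  have : 0 ≤ ε⁻¹ * (x - t) ^ 2 := by positivity
  linarith

theorem exists_resolvent_vector {T : H →L[ℂ] H} (hT : IsSelfAdjoint T) (v : H) {z : ℂ}
    (hz : z.im ≠ 0) : ∃ ψ : H, T ψ = z • ψ + v := by
  have h1 : z ∉ spectrum ℂ T := fun h => hz (hT.im_eq_zero_of_mem_spectrum h)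
  rw [spectrum.notMem_iff] at h1
  obtain ⟨u, hu⟩ := h1
  refine ⟨-((↑u⁻¹ : H →L[ℂ] H) v), ?_⟩
  have h2 : (u : H →L[ℂ] H) ((↑u⁻¹ : H →L[ℂ] H) v) = v := by
    rw [← mul_apply_eq_comp, Units.mul_inv, one_apply_eq_self]
  rw [hu] at h2
  simp only [sub_apply, Algebra.algebraMap_eq_smul_one,
    smul_apply, one_apply_eq_self] at h2
  rw [map_neg, smul_neg]
  nth_rewrite 3 [← h2]
  abel

/-- The Poisson integral of the spectral measure is the imaginary part of the resolvent matrix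
element `⟨v, (T - z)⁻¹ v⟩`, `z = x + i ε`. -/
theorem inner_cfc_poissonKer {T : H →L[ℂ] H} (hT : IsSelfAdjoint T) {v ψ : H} {x ε : ℝ}
    (hε : 0 < ε) (hψ : T ψ = (x + ε * Complex.I : ℂ) • ψ + v) :
    (⟪v, cfc (poissonKer ε x) T v⟫_ℂ).re = (⟪v, ψ⟫_ℂ).im := by
  set k : ℝ → ℝ := fun t => ((x - t) ^ 2 + ε ^ 2)⁻¹ with hk
  have hkc : Continuous k :=
    Continuous.inv₀ (by fun_prop) fun t => (poissonKer_den_pos hε x t).ne'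
  have e1 : cfc (poissonKer ε x) T = ε • cfc k T := by
    rw [← cfc_smul (a := T) ε k hkc.continuousOn]
    rfl
  set z : ℂ := x + ε * Complex.I with hz
  set A := cfc k T with hA
  have hcomm : Commute T A := ((Commute.refl T).cfc_real k).symm
  have hprod : A * ((T - (x : ℂ) • (1 : H →L[ℂ] H)) ^ 2 + ((ε ^ 2 : ℝ) : ℂ) • 1) = 1 := by
    have hB : cfc (fun t : ℝ => (x - t) ^ 2 + ε ^ 2) T =
        (T - (x : ℂ) • (1 : H →L[ℂ] H)) ^ 2 + ((ε ^ 2 : ℝ) : ℂ) • 1 := by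
      rw [cfc_add (a := T) (fun t : ℝ => (x - t) ^ 2) (fun _ => ε ^ 2) (by fun_prop) (by fun_prop),
        cfc_pow (fun t : ℝ => x - t) 2 T (by fun_prop), cfc_const (ε ^ 2) T,
        cfc_sub (a := T) (fun _ => x) (fun t => t) (by fun_prop) (by fun_prop), cfc_const x T,
        cfc_id' ℝ T, Algebra.algebraMap_eq_smul_one, Algebra.algebraMap_eq_smul_one, ← neg_sub,
        neg_sq, Complex.coe_smul, Complex.coe_smul]
    rw [← hB, hA, ← cfc_mul (a := T) k _ hkc.continuousOn (by fun_prop)]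
    have : (fun t => k t * ((x - t) ^ 2 + ε ^ 2)) = fun _ => (1 : ℝ) := by
      funext t
      exact inv_mul_cancel₀ (poissonKer_den_pos hε x t).ne'
    rw [this, cfc_const_one ℝ T]
  have hv : v = T ψ - z • ψ := by rw [hψ]; abel
  have hfac : (T - (starRingEnd ℂ z) • (1 : H →L[ℂ] H)) * (T - z • (1 : H →L[ℂ] H)) =
      (T - (x : ℂ) • (1 : H →L[ℂ] H)) ^ 2 + ((ε ^ 2 : ℝ) : ℂ) • 1 := by
    have h1 : starRingEnd ℂ z = x - ε * Complex.I := by simp [hz, sub_eq_add_neg]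
    have h2 : T - (x - ε * Complex.I : ℂ) • (1 : H →L[ℂ] H) =
        (T - (x : ℂ) • 1) + (ε * Complex.I : ℂ) • 1 := by rw [sub_smul]; abel
    have h3 : T - (x + ε * Complex.I : ℂ) • (1 : H →L[ℂ] H) =
        (T - (x : ℂ) • 1) - (ε * Complex.I : ℂ) • 1 := by rw [add_smul]; abel
    have h4 : ((ε ^ 2 : ℝ) : ℂ) = -(ε * Complex.I * (ε * Complex.I)) := by
      push_cast
      linear_combination ((ε : ℂ) ^ 2) * Complex.I_sq
    rw [h1, hz, h2, h3, h4]
    generalize T - (x : ℂ) • (1 : H →L[ℂ] H) = Y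
    simp only [add_mul, mul_sub, sq, smul_mul_assoc, mul_smul_comm, one_mul, mul_one,
      smul_add, smul_smul, neg_smul]
    abel
  -- With `v = (T - z) ψ`, moving one factor to the other side cancels `A` against `|T - z|²`.
  have key : ⟪v, A v⟫_ℂ = ⟪ψ, ψ⟫_ℂ := by
    have hv2 : v = (T - z • (1 : H →L[ℂ] H)) ψ := by
      rw [hv]; simp
    have hadj : ContinuousLinearMap.adjoint (T - z • (1 : H →L[ℂ] H)) =
        T - (starRingEnd ℂ z) • (1 : H →L[ℂ] H) := by
      rw [← ContinuousLinearMap.star_eq_adjoint, star_sub, star_smul, hT.star_eq, star_one]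
      rfl
    have hc2 : Commute A (T - (starRingEnd ℂ z) • (1 : H →L[ℂ] H)) :=
      hcomm.symm.sub_right ((Commute.one_right A).smul_right _)
    rw [hv2, ← ContinuousLinearMap.adjoint_inner_right, hadj]
    congr 1
    rw [← mul_apply_eq_comp, ← mul_apply_eq_comp, ← hc2.eq, mul_assoc, hfac,
      hprod, one_apply_eq_self]
  rw [e1, smul_apply, ← Complex.coe_smul, inner_smul_right, key]
  have hsym : (⟪T ψ, ψ⟫_ℂ).im = 0 := by
    have h1 : ⟪T ψ, ψ⟫_ℂ = ⟪ψ, T ψ⟫_ℂ := by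
      rw [← ContinuousLinearMap.adjoint_inner_right, ← ContinuousLinearMap.star_eq_adjoint,
        hT.star_eq]
    exact Complex.conj_eq_iff_im.1 (by rw [inner_conj_symm, h1])
  have hpp : ⟪ψ, ψ⟫_ℂ = ((‖ψ‖ ^ 2 : ℝ) : ℂ) := by
    rw [inner_self_eq_norm_sq_to_K]; push_cast; rfl
  rw [hv, inner_sub_left, inner_smul_left, Complex.sub_im, hsym, hpp, hz]
  simp
  exact Or.inr (by rw [← Complex.ofReal_pow, Complex.ofReal_im])

theorem integrable_cauchy_density : Integrable fun s : ℝ => Real.pi⁻¹ * (1 + s ^ 2)⁻¹ :=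
  integrable_inv_one_add_sq.const_mul _

theorem integral_cauchy_density : ∫ s : ℝ, Real.pi⁻¹ * (1 + s ^ 2)⁻¹ = 1 := by
  rw [integral_const_mul, integral_univ_inv_one_add_sq, inv_mul_cancel₀ Real.pi_ne_zero]

theorem continuous_integral_cauchy (f : C_c(ℝ, ℝ)) :
    Continuous fun q : ℝ × ℝ => ∫ s : ℝ, f (q.2 + q.1 * s) * (Real.pi⁻¹ * (1 + s ^ 2)⁻¹) := by
  obtain ⟨M, hM⟩ := f.hasCompactSupport.exists_bound_of_continuous f.continuous
  refine continuous_of_dominated (bound := fun s => M * (Real.pi⁻¹ * (1 + s ^ 2)⁻¹))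
    (fun q => ?_) (fun q => Eventually.of_forall fun s => ?_)
    (integrable_cauchy_density.const_mul M) (Eventually.of_forall fun s => ?_)
  · refine Continuous.aestronglyMeasurable ?_
    have h1 : Continuous fun s : ℝ => (1 + s ^ 2)⁻¹ :=
      Continuous.inv₀ (by fun_prop) fun s => by positivity
    have h2 : Continuous fun s : ℝ => f (q.2 + q.1 * s) := f.continuous.comp (by fun_prop)
    exact h2.mul (h1.const_mul _)
  · rw [norm_mul, Real.norm_of_nonneg (r := Real.pi⁻¹ * (1 + s ^ 2)⁻¹) (by positivity)]
    gcongr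
    exact hM _
  · have h2 : Continuous fun q : ℝ × ℝ => f (q.2 + q.1 * s) := f.continuous.comp (by fun_prop)
    exact h2.mul continuous_const

theorem integral_mul_poissonKer (f : ℝ → ℝ) {ε : ℝ} (hε : 0 < ε) (t : ℝ) :
    ∫ x, f x * (Real.pi⁻¹ * poissonKer ε x t) =
      ∫ s, f (t + ε * s) * (Real.pi⁻¹ * (1 + s ^ 2)⁻¹) := by
  have h1 : ∫ x, f x * (Real.pi⁻¹ * poissonKer ε x t) =
      ∫ y, f (y + t) * (Real.pi⁻¹ * poissonKer ε (y + t) t) :=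
    (integral_add_right_eq_self (μ := volume)
      (fun x => f x * (Real.pi⁻¹ * poissonKer ε x t)) t).symm
  have h2 := Measure.integral_comp_mul_left
    (fun y => f (y + t) * (Real.pi⁻¹ * poissonKer ε (y + t) t)) ε
  rw [h1]
  rw [abs_of_pos (inv_pos.2 hε), smul_eq_mul, eq_comm, inv_mul_eq_iff_eq_mul₀ hε.ne'] at h2
  rw [h2, ← integral_const_mul]
  congr 1
  funext s
  have h3 : (1 + s ^ 2) ≠ 0 := by positivity
  rw [poissonKer, add_comm t]
  have : (ε * s + t - t) ^ 2 + ε ^ 2 = ε ^ 2 * (1 + s ^ 2) := by ring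
  rw [this]
  field_simp

/-- Stieltjes inversion: the matrix elements of the functional calculus are recovered from the
boundary behaviour of the Poisson integrals. -/
theorem tendsto_integral_poissonKer {T : H →L[ℂ] H} (hT : IsSelfAdjoint T) (v : H)
    (f : C_c(ℝ, ℝ)) :
    Tendsto (fun ε : ℝ => ∫ x, f x * (Real.pi⁻¹ * (⟪v, cfc (poissonKer ε x) T v⟫_ℂ).re))
      (𝓝[>] 0) (𝓝 (⟪v, cfc (f : ℝ → ℝ) T v⟫_ℂ).re) := by
  obtain ⟨M, hM⟩ := f.hasCompactSupport.exists_bound_of_continuous f.continuous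
  -- `Φ ε` is the Poisson integral of `f`, rescaled so that it is also continuous at `ε = 0`.
  set Φ : ℝ → ℝ → ℝ := fun ε t => ∫ s : ℝ, f (t + ε * s) * (Real.pi⁻¹ * (1 + s ^ 2)⁻¹) with hΦ
  have hΦc : Continuous fun q : ℝ × ℝ => Φ q.1 q.2 := continuous_integral_cauchy f
  have hΦ0 : Φ 0 = f := by
    funext t
    simp only [hΦ, zero_mul, add_zero]
    rw [integral_const_mul, integral_cauchy_density, mul_one]
  let L : (H →L[ℂ] H) →L[ℝ] ℝ :=
    Complex.reCLM.comp (((innerSL ℂ v).comp (ContinuousLinearMap.apply ℂ H v)).restrictScalars ℝ)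
  have hL : ∀ A : H →L[ℂ] H, L A = (⟪v, A v⟫_ℂ).re := fun A => rfl
  have hlim : Tendsto (fun ε => cfc (Φ ε) T) (𝓝 0) (𝓝 (cfc (Φ 0) T)) := by
    refine tendsto_cfc_fun ?_ (Eventually.of_forall fun ε => ?_)
    · have : CompactSpace (spectrum ℝ T) :=
        isCompact_iff_compactSpace.1 (ContinuousFunctionalCalculus.isCompact_spectrum T)
      rw [tendstoUniformlyOn_iff_tendstoUniformly_comp_coe]
      exact Continuous.tendstoUniformly (fun (ε : ℝ) (t : spectrum ℝ T) => Φ ε t)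
        (hΦc.comp (by fun_prop : Continuous fun q : ℝ × spectrum ℝ T => (q.1, (q.2 : ℝ)))) 0
    · exact (hΦc.comp (by fun_prop : Continuous fun t : ℝ => (ε, t))).continuousOn
  rw [hΦ0] at hlim
  have hlim2 := (L.continuous.tendsto _).comp (hlim.mono_left (nhdsWithin_le_nhds (s := Ioi 0)))
  rw [hL] at hlim2
  refine hlim2.congr' ?_
  filter_upwards [self_mem_nhdsWithin] with ε hε
  have hε : 0 < ε := hε
  have hcont : ContinuousOn (Function.uncurry fun x t => f x * (Real.pi⁻¹ * poissonKer ε x t))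
      (univ ×ˢ spectrum ℝ T) :=
    ((f.continuous.comp continuous_fst).mul
      (continuous_const.mul (continuous_poissonKer hε))).continuousOn
  have hbound : ∀ x, ∀ t ∈ spectrum ℝ T, ‖f x * (Real.pi⁻¹ * poissonKer ε x t)‖ ≤
      |f x| * (Real.pi⁻¹ * ε⁻¹) := by
    intro x t _
    rw [norm_mul, norm_mul, Real.norm_eq_abs, Real.norm_eq_abs, Real.norm_eq_abs,
      abs_of_pos (inv_pos.2 Real.pi_pos)]
    gcongr
    exact abs_poissonKer_le hε x t
  have hfin : HasFiniteIntegral fun x => |f x| * (Real.pi⁻¹ * ε⁻¹) :=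
    ((f.continuous.integrable_of_hasCompactSupport f.hasCompactSupport).abs.mul_const
      _).hasFiniteIntegral
  have e1 : cfc (Φ ε) T = ∫ x, cfc (fun t => f x * (Real.pi⁻¹ * poissonKer ε x t)) T := by
    have : Φ ε = fun t => ∫ x, f x * (Real.pi⁻¹ * poissonKer ε x t) := by
      funext t
      rw [integral_mul_poissonKer _ hε]
    rw [this]
    exact cfc_integral _ _ T hcont (Eventually.of_forall hbound) hfin
  have hint : Integrable fun x => cfc (fun t => f x * (Real.pi⁻¹ * poissonKer ε x t)) T :=
    integrable_cfc _ _ T hcont (Eventually.of_forall hbound) hfin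
  rw [Function.comp_apply, e1, ← ContinuousLinearMap.integral_comp_comm L hint]
  congr 1
  funext x
  have hc : Continuous (poissonKer ε x) :=
    (continuous_poissonKer hε).comp (by fun_prop : Continuous fun t : ℝ => (x, t))
  have e2 : cfc (fun t => f x * (Real.pi⁻¹ * poissonKer ε x t)) T =
      (f x * Real.pi⁻¹) • cfc (poissonKer ε x) T := by
    rw [← cfc_smul (a := T) _ _ hc.continuousOn]
    simp only [smul_eq_mul, mul_assoc]
  rw [e2, map_smul, hL, smul_eq_mul, mul_assoc]

/-- Stieltjes inversion in terms of the imaginary part `m` of the resolvent matrix element. -/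
theorem tendsto_integral_spectralMeasure {T : H →L[ℂ] H} (hT : IsSelfAdjoint T) (v : H)
    (f : C_c(ℝ, ℝ)) {m : ℝ → ℝ → ℝ}
    (hm : ∀ x ε : ℝ, 0 < ε → ∀ ψ, T ψ = (x + ε * Complex.I : ℂ) • ψ + v → (⟪v, ψ⟫_ℂ).im = m x ε) :
    Tendsto (fun ε : ℝ => ∫ x, f x * (Real.pi⁻¹ * m x ε)) (𝓝[>] 0)
      (𝓝 (∫ x, f x ∂(spectralMeasure T hT v))) := by
  rw [integral_spectralMeasure]
  refine (tendsto_integral_poissonKer hT v f).congr' ?_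
  filter_upwards [self_mem_nhdsWithin] with ε hε
  congr 1
  funext x
  have hε : 0 < ε := hε
  obtain ⟨ψ, hψ⟩ := exists_resolvent_vector hT v (z := x + ε * Complex.I) (by simpa using hε.ne')
  rw [inner_cfc_poissonKer hT hε hψ, hm x ε hε ψ hψ]

/-- Spectral measures depend continuously (in the vague topology) on the operator. -/
theorem tendsto_integral_spectralMeasure_of_tendsto {T : ℕ → H →L[ℂ] H} {T₀ : H →L[ℂ] H}
    (hT : ∀ n, IsSelfAdjoint (T n)) (hT₀ : IsSelfAdjoint T₀) (hlim : Tendsto T atTop (𝓝 T₀)) (v : H)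
    (f : C_c(ℝ, ℝ)) :
    Tendsto (fun n => ∫ x, f x ∂(spectralMeasure (T n) (hT n) v)) atTop
      (𝓝 (∫ x, f x ∂(spectralMeasure T₀ hT₀ v))) := by
  simp only [integral_spectralMeasure]
  obtain ⟨R, hR⟩ := hlim.norm.bddAbove_range
  have hR' : ∀ n, ‖T n‖ ≤ R := fun n => hR ⟨n, rfl⟩
  have hR0 : ‖T₀‖ ≤ R := le_of_tendsto' hlim.norm hR'
  have hsub : ∀ A : H →L[ℂ] H, ‖A‖ ≤ R → spectrum ℝ A ⊆ Metric.closedBall 0 R := by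
    intro A hA
    rcases subsingleton_or_nontrivial H with h | h
    · rw [spectrum.of_subsingleton]
      exact empty_subset _
    · exact (spectrum.subset_closedBall_norm A).trans (Metric.closedBall_subset_closedBall hA)
  have hcfc := Filter.Tendsto.cfc (isCompact_closedBall (0 : ℝ) R) (f : ℝ → ℝ) hlim
    (Eventually.of_forall fun n => hsub _ (hR' n)) (Eventually.of_forall hT) (hsub _ hR0) hT₀
    f.continuous.continuousOn
  have hc : Continuous fun A : H →L[ℂ] H => (⟪v, A v⟫_ℂ).re := by fun_prop
  exact (hc.tendsto _).comp hcfc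

end StieltjesInversion

/-! ### The three-term recursion and the Weyl function for an eventually vanishing diagonal -/

section Recursion

variable {R : Type*} [CommRing R]

/-- The solution `u` of `u (n + 2) = (z - b (n + 1)) u (n + 1) - u n` with `u 0 = s`, `u 1 = t`. The
index is shifted by one: `u (n + 1)` is the entry at the site `n` of `ℤ≥0`, and `u 0` is a boundary
value. -/
def recSol (b : ℕ → R) (s t z : R) : ℕ → R
  | 0 => s
  | 1 => t
  | n + 2 => (z - b (n + 1)) * recSol b s t z (n + 1) - recSol b s t z n

/-- The orthonormal polynomials of the Jacobi matrix with off-diagonal entries `1`, with index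
shifted by one: `orthoPoly b x (n + 1)` has degree `n`, and `orthoPoly b x 0 = 0`. -/
def orthoPoly (b : ℕ → R) (z : R) : ℕ → R := recSol b 0 1 z

/-- The polynomials of the second kind, normalized to have Wronskian `-1` with `orthoPoly`. -/
def secondPoly (b : ℕ → R) (z : R) : ℕ → R := recSol b (-1) 0 z

theorem recSol_add_two (b : ℕ → R) (s t z : R) (n : ℕ) :
    recSol b s t z (n + 2) = (z - b (n + 1)) * recSol b s t z (n + 1) - recSol b s t z n := rfl

@[simp] theorem orthoPoly_zero (b : ℕ → R) (z : R) : orthoPoly b z 0 = 0 := rfl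

@[simp] theorem orthoPoly_one (b : ℕ → R) (z : R) : orthoPoly b z 1 = 1 := rfl

theorem orthoPoly_add_two (b : ℕ → R) (z : R) (n : ℕ) :
    orthoPoly b z (n + 2) = (z - b (n + 1)) * orthoPoly b z (n + 1) - orthoPoly b z n := rfl

theorem secondPoly_add_two (b : ℕ → R) (z : R) (n : ℕ) :
    secondPoly b z (n + 2) = (z - b (n + 1)) * secondPoly b z (n + 1) - secondPoly b z n := rfl

theorem wronskian_orthoPoly_secondPoly (b : ℕ → R) (z : R) (n : ℕ) :
    orthoPoly b z (n + 1) * secondPoly b z n - orthoPoly b z n * secondPoly b z (n + 1) = -1 := by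
  induction n with
  | zero => simp [orthoPoly, secondPoly, recSol]
  | succ n ih =>
    rw [orthoPoly_add_two, secondPoly_add_two]
    linear_combination ih

theorem eq_orthoPoly_add_secondPoly {b : ℕ → R} {z : R} {u : ℕ → R} (h0 : u 0 = -1)
    (hu : ∀ n, u (n + 2) = (z - b (n + 1)) * u (n + 1) - u n) (n : ℕ) :
    u n = u 1 * orthoPoly b z n + secondPoly b z n := by
  induction n using Nat.twoStepInduction with
  | zero => simp [orthoPoly, secondPoly, recSol, h0]
  | one => simp [orthoPoly, secondPoly, recSol]
  | more n h1 h2 =>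
    rw [hu, h1, h2, orthoPoly_add_two, secondPoly_add_two]
    ring

theorem continuous_recSol [TopologicalSpace R] [IsTopologicalRing R] (b : ℕ → R) (s t : R) (n : ℕ) :
    Continuous fun z => recSol b s t z n := by
  induction n using Nat.twoStepInduction with
  | zero => exact continuous_const
  | one => exact continuous_const
  | more n h1 h2 => exact ((continuous_id.sub continuous_const).mul h2).sub h1

theorem recSol_map {S : Type*} [CommRing S] (φ : R →+* S) (b : ℕ → R) (s t z : R) (n : ℕ) :
    recSol (fun k => φ (b k)) (φ s) (φ t) (φ z) n = φ (recSol b s t z n) := by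
  induction n using Nat.twoStepInduction with
  | zero => rfl
  | one => rfl
  | more n h1 h2 => rw [recSol_add_two, recSol_add_two, h1, h2]; simp

end Recursion

theorem orthoPoly_ofReal (b : ℕ → ℝ) (x : ℝ) (n : ℕ) :
    orthoPoly (fun k => (b k : ℂ)) (x : ℂ) n = ((orthoPoly b x n : ℝ) : ℂ) := by
  simpa [orthoPoly] using recSol_map Complex.ofRealHom b 0 1 x n

theorem secondPoly_ofReal (b : ℕ → ℝ) (x : ℝ) (n : ℕ) :
    secondPoly (fun k => (b k : ℂ)) (x : ℂ) n = ((secondPoly b x n : ℝ) : ℂ) := by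
  simpa [secondPoly] using recSol_map Complex.ofRealHom b (-1) 0 x n

section Joukowski

/-- The root `ζ` of `ζ + 1/ζ = z` that lies in the unit disc when `z` is in the upper half-plane. On
the strip `|Re z| < 2` this choice of square root is continuous up to the real axis. -/
def joukowskiRoot (z : ℂ) : ℂ := z / 2 - Complex.I * (1 - z ^ 2 / 4).sqrt

theorem joukowskiRoot_mul (z : ℂ) : (z - joukowskiRoot z) * joukowskiRoot z = 1 := by
  have h : (1 - z ^ 2 / 4).sqrt ^ 2 = 1 - z ^ 2 / 4 := by
    simp [Complex.sqrt]
  unfold joukowskiRoot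
  linear_combination h - (1 - z ^ 2 / 4).sqrt ^ 2 * Complex.I_sq

theorem norm_joukowskiRoot_lt_one {z : ℂ} (hz : 0 < z.im) : ‖joukowskiRoot z‖ < 1 := by
  set ζ := joukowskiRoot z with hζ
  set η := z - ζ with hη
  have h1 : η * ζ = 1 := joukowskiRoot_mul z
  have h2 : 0 < η.im := by
    have h3 : η = z / 2 + Complex.I * (1 - z ^ 2 / 4).sqrt := by
      rw [hη, hζ, joukowskiRoot]; ring
    have h4 : 0 ≤ ((1 - z ^ 2 / 4).sqrt).re := by
      rw [Complex.sqrt, Complex.cpow_inv_two_re]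
      positivity
    rw [h3]
    simp
    linarith
  have h5 : ζ = η⁻¹ := eq_inv_of_mul_eq_one_right h1
  have hη0 : η ≠ 0 := left_ne_zero_of_mul_eq_one h1
  have h6 : z.im = η.im + ζ.im := by rw [hη]; simp
  have hpos : 0 < Complex.normSq η := Complex.normSq_pos.2 hη0
  rw [h5, Complex.inv_im] at h6
  have h7 : 1 < Complex.normSq η := by
    by_contra! h
    have : η.im ≤ η.im / Complex.normSq η := by
      rw [le_div_iff₀ hpos]
      nlinarith
    rw [neg_div] at h6
    linarith
  rw [h5, norm_inv]
  refine inv_lt_one_of_one_lt₀ ?_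
  rw [Complex.normSq_eq_norm_sq] at h7
  nlinarith [norm_nonneg η]

theorem continuousAt_joukowskiRoot {z : ℂ} (hz : |z.re| < 2) : ContinuousAt joukowskiRoot z := by
  have h : 1 - z ^ 2 / 4 ∈ Complex.slitPlane := by
    left
    have h1 : (1 - z ^ 2 / 4).re = 1 - (z.re ^ 2 - z.im ^ 2) / 4 := by
      have : z ^ 2 / 4 = z ^ 2 * ((1 / 4 : ℝ) : ℂ) := by push_cast; ring
      rw [this, Complex.sub_re, Complex.re_mul_ofReal, Complex.one_re, sq, Complex.mul_re]
      ring
    rw [h1]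
    have := (abs_lt.1 hz)
    nlinarith [sq_nonneg z.im, this.1, this.2]
  unfold joukowskiRoot
  refine (continuousAt_id.div_const 2).sub (continuousAt_const.mul ?_)
  exact ContinuousAt.comp (g := fun w : ℂ => w ^ (2⁻¹ : ℂ)) (f := fun z : ℂ => 1 - z ^ 2 / 4)
    (continuousAt_cpow_const h) (by fun_prop)

theorem joukowskiRoot_ofReal {x : ℝ} (hx : x ∈ Ioo (-2 : ℝ) 2) :
    joukowskiRoot x = ((x / 2 : ℝ) : ℂ) + ((-(√(4 - x ^ 2) / 2) : ℝ) : ℂ) * Complex.I := by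
  have h0 : 0 ≤ 1 - x ^ 2 / 4 := by nlinarith [hx.1, hx.2]
  have h1 : ((1 : ℂ) - (x : ℂ) ^ 2 / 4).sqrt = ((√(4 - x ^ 2) / 2 : ℝ) : ℂ) := by
    have h2 : (1 : ℂ) - (x : ℂ) ^ 2 / 4 = ((1 - x ^ 2 / 4 : ℝ) : ℂ) := by push_cast; ring
    have h3 : √(1 - x ^ 2 / 4) = √(4 - x ^ 2) / 2 := by
      rw [show 1 - x ^ 2 / 4 = (4 - x ^ 2) / 2 ^ 2 by ring, Real.sqrt_div' _ (by positivity),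
        Real.sqrt_sq (by norm_num)]
    rw [h2, Complex.sqrt_of_nonneg (by exact_mod_cast h0), Complex.ofReal_re, h3]
  rw [joukowskiRoot, h1]
  push_cast
  ring

/-- A solution of the free recursion that tends to zero is a multiple of the powers of `ζ`. -/
theorem eq_joukowskiRoot_mul {z : ℂ} (hz : 0 < z.im) {N : ℕ} {u : ℕ → ℂ}
    (hu : ∀ n, N ≤ n → u (n + 2) = z * u (n + 1) - u n) (hlim : Tendsto u atTop (𝓝 0)) :
    u (N + 1) = joukowskiRoot z * u N := by
  set ζ := joukowskiRoot z
  have hmul : (z - ζ) * ζ = 1 := joukowskiRoot_mul z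
  -- `χ` removes the decaying part of `u`; it grows like `ζ⁻ⁿ` unless it vanishes.
  set χ : ℕ → ℂ := fun n => u (n + 1) - ζ * u n with hχ
  have h1 : ∀ k, χ N = ζ ^ k * χ (N + k) := by
    intro k
    induction k with
    | zero => simp
    | succ k ih =>
      rw [ih, pow_succ, mul_assoc]
      congr 1
      simp only [hχ]
      rw [show N + (k + 1) + 1 = N + k + 2 by ring, show N + (k + 1) = N + k + 1 by ring,
        hu (N + k) (by omega)]
      linear_combination (-(u (N + k + 1))) * hmul
  have hχlim : Tendsto (fun k => ‖χ (N + k)‖) atTop (𝓝 0) := by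
    have h2 : Tendsto χ atTop (𝓝 (0 - ζ * 0)) :=
      ((tendsto_add_atTop_iff_nat 1).2 hlim).sub (hlim.const_mul ζ)
    rw [mul_zero, sub_zero] at h2
    have h3 := (tendsto_add_atTop_iff_nat N).2 h2.norm
    simpa [add_comm] using h3
  have h4 : ‖χ N‖ ≤ 0 := by
    refine ge_of_tendsto' hχlim fun k => ?_
    rw [h1 k, norm_mul, norm_pow]
    exact mul_le_of_le_one_left (norm_nonneg _)
      (pow_le_one₀ (norm_nonneg _) (norm_joukowskiRoot_lt_one hz).le)
  exact sub_eq_zero.1 (norm_le_zero_iff.1 h4)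

end Joukowski

section FreeTail

/-- The Weyl function `⟨δ₀, (J - z)⁻¹ δ₀⟩` of a Jacobi matrix with off-diagonal entries `1` whose
diagonal entries vanish beyond the index `N`. -/
def weylFun (b : ℕ → ℝ) (N : ℕ) (z : ℂ) : ℂ :=
  -(secondPoly (fun k => (b k : ℂ)) z (N + 1) -
      joukowskiRoot z * secondPoly (fun k => (b k : ℂ)) z N) /
    (orthoPoly (fun k => (b k : ℂ)) z (N + 1) -
      joukowskiRoot z * orthoPoly (fun k => (b k : ℂ)) z N)

/-- `|p_N - ζ p_{N-1}|²` for real `x` in `(-2, 2)`, where `ζ + 1/ζ = x`. -/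
def jostSq (b : ℕ → ℝ) (N : ℕ) (x : ℝ) : ℝ :=
  orthoPoly b x (N + 1) ^ 2 - x * orthoPoly b x (N + 1) * orthoPoly b x N + orthoPoly b x N ^ 2

theorem orthoPoly_ne_zero_or (b : ℕ → ℝ) (x : ℝ) (n : ℕ) :
    orthoPoly b x (n + 1) ≠ 0 ∨ orthoPoly b x n ≠ 0 := by
  by_contra! h
  have := wronskian_orthoPoly_secondPoly b x n
  rw [h.1, h.2] at this
  norm_num at this

theorem quadForm_pos {c p q : ℝ} (hc : c ∈ Ioo (-2 : ℝ) 2) (h : p ≠ 0 ∨ q ≠ 0) :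
    0 < p ^ 2 - c * p * q + q ^ 2 := by
  have h1 : p ^ 2 - c * p * q + q ^ 2 =
      (2 - c) / 4 * (p + q) ^ 2 + (2 + c) / 4 * (p - q) ^ 2 := by ring
  rw [h1]
  have h2 : 0 < (2 - c) / 4 := by linarith [hc.2]
  have h3 : 0 < (2 + c) / 4 := by linarith [hc.1]
  have h4 : p + q ≠ 0 ∨ p - q ≠ 0 := by
    by_contra! h5
    have : p = 0 := by linarith [h5.1, h5.2]
    have : q = 0 := by linarith [h5.1, h5.2]
    tauto
  rcases h4 with h4 | h4
  · have := sq_pos_of_ne_zero h4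
    positivity
  · have := sq_pos_of_ne_zero h4
    positivity

theorem jostSq_pos (b : ℕ → ℝ) (N : ℕ) {x : ℝ} (hx : x ∈ Ioo (-2 : ℝ) 2) : 0 < jostSq b N x :=
  quadForm_pos hx (orthoPoly_ne_zero_or b x N)

theorem continuous_jostSq (b : ℕ → ℝ) (N : ℕ) : Continuous (jostSq b N) := by
  have h1 : Continuous fun x => orthoPoly b x (N + 1) := continuous_recSol b 0 1 _
  have h2 : Continuous fun x => orthoPoly b x N := continuous_recSol b 0 1 _
  exact ((h1.pow 2).sub ((continuous_id.mul h1).mul h2)).add (h2.pow 2)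

/-- The density of the spectral measure on `(-2, 2)` when the diagonal vanishes beyond `N`. -/
def freeTailWeight (b : ℕ → ℝ) (N : ℕ) (x : ℝ) : ℝ := √(4 - x ^ 2) / (2 * Real.pi * jostSq b N x)

theorem continuousOn_freeTailWeight (b : ℕ → ℝ) (N : ℕ) :
    ContinuousOn (freeTailWeight b N) (Ioo (-2) 2) := by
  refine ContinuousOn.div (by fun_prop)
    (continuous_const.mul (continuous_jostSq b N)).continuousOn fun x hx => ?_
  have := jostSq_pos b N hx
  positivity

theorem weylFun_den_ofReal_ne_zero (b : ℕ → ℝ) (N : ℕ) {x : ℝ} (hx : x ∈ Ioo (-2 : ℝ) 2) :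
    orthoPoly (fun k => (b k : ℂ)) (x : ℂ) (N + 1) -
      joukowskiRoot x * orthoPoly (fun k => (b k : ℂ)) (x : ℂ) N ≠ 0 := by
  intro h
  have hD := jostSq_pos b N hx
  rw [joukowskiRoot_ofReal hx, orthoPoly_ofReal, orthoPoly_ofReal] at h
  have hre := congrArg Complex.re h
  have him := congrArg Complex.im h
  simp [-Complex.ofReal_div, -Complex.ofReal_neg] at hre him
  have hs : 0 < √(4 - x ^ 2) := Real.sqrt_pos.2 (by nlinarith [hx.1, hx.2])
  have h0 : orthoPoly b x N = 0 := by
    rcases him with h | h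
    · exact absurd h hs.ne'
    · exact h
  rw [h0] at hre
  rw [jostSq, h0] at hD
  simp at hre
  rw [hre] at hD
  simp at hD

theorem weylFun_ofReal_im (b : ℕ → ℝ) (N : ℕ) {x : ℝ} (hx : x ∈ Ioo (-2 : ℝ) 2) :
    Real.pi⁻¹ * (weylFun b N x).im = freeTailWeight b N x := by
  have hD := jostSq_pos b N hx
  have hw := wronskian_orthoPoly_secondPoly b x N
  have hs : √(4 - x ^ 2) ^ 2 = 4 - x ^ 2 := Real.sq_sqrt (by nlinarith [hx.1, hx.2])
  rw [weylFun, Complex.div_im, joukowskiRoot_ofReal hx, orthoPoly_ofReal, orthoPoly_ofReal,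
    secondPoly_ofReal, secondPoly_ofReal]
  set p := orthoPoly b x (N + 1)
  set q := orthoPoly b x N
  set r := secondPoly b x (N + 1)
  set s := secondPoly b x N
  set σ := √(4 - x ^ 2)
  have hn : Complex.normSq ((p : ℂ) - (((x / 2 : ℝ) : ℂ) + ((-(σ / 2) : ℝ) : ℂ) * Complex.I) * q) =
      jostSq b N x := by
    rw [Complex.normSq_apply]
    simp [-Complex.ofReal_div, -Complex.ofReal_neg]
    rw [jostSq]
    linear_combination (q ^ 2 / 4) * hs
  rw [hn, freeTailWeight, ← sub_div]
  simp [-Complex.ofReal_div, -Complex.ofReal_neg]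
  field_simp
  linear_combination (-2 * σ) * hw

end FreeTail

/-! ### Spectral measures for eventually vanishing diagonals, and truncation -/

section FreeTailMeasure

theorem inner_deltaZero (ψ : EllTwo) : ⟪deltaZero, ψ⟫_ℂ = ψ 0 := by
  rw [deltaZero, lp.inner_single_left]
  simp

theorem tendsto_coeff_zero (ψ : EllTwo) : Tendsto (fun n => ψ n) atTop (𝓝 0) := by
  have h := (JacobiParameters.memlp_two_iff _).1 (lp.memℓp ψ)
  have h1 := h.tendsto_atTop_zero
  rw [tendsto_zero_iff_norm_tendsto_zero]
  have h2 := (Real.continuous_sqrt.tendsto 0).comp h1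
  simpa [Function.comp_def, Real.sqrt_sq] using h2

/-- The resolvent vector of a Jacobi operator with off-diagonal entries `1`, extended by the value
`-1` at the site `-1`. -/
def extendedCoeff (ψ : EllTwo) : ℕ → ℂ
  | 0 => -1
  | n + 1 => ψ n

theorem extendedCoeff_add_two {P : JacobiParameters} (ha : ∀ n, 1 ≤ n → P.a n = 1) {z : ℂ}
    {ψ : EllTwo} (hψ : P.jacobiOperator ψ = z • ψ + deltaZero) (n : ℕ) :
    extendedCoeff ψ (n + 2) = (z - P.b (n + 1)) * extendedCoeff ψ (n + 1) - extendedCoeff ψ n := by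
  have h := congrArg (fun φ : EllTwo => φ n) hψ
  simp only [JacobiParameters.jacobiOperator_apply] at h
  rw [lp.coeFn_add, lp.coeFn_smul, Pi.add_apply, Pi.smul_apply, smul_eq_mul] at h
  cases n with
  | zero =>
    simp [JacobiParameters.jacobiFun, ha, deltaZero] at h
    simp only [extendedCoeff]
    linear_combination h
  | succ n =>
    simp [JacobiParameters.jacobiFun, ha, deltaZero] at h
    simp only [extendedCoeff]
    linear_combination h

variable {P : JacobiParameters} {N : ℕ}

theorem coeff_zero_mul_den (ha : ∀ n, 1 ≤ n → P.a n = 1) (hb : ∀ n, N < n → P.b n = 0) {z : ℂ}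
    (hz : 0 < z.im) {ψ : EllTwo} (hψ : P.jacobiOperator ψ = z • ψ + deltaZero) :
    ψ 0 * (orthoPoly (fun k => (P.b k : ℂ)) z (N + 1) -
      joukowskiRoot z * orthoPoly (fun k => (P.b k : ℂ)) z N) =
    -(secondPoly (fun k => (P.b k : ℂ)) z (N + 1) -
      joukowskiRoot z * secondPoly (fun k => (P.b k : ℂ)) z N) := by
  have hrec := extendedCoeff_add_two ha hψ
  have hlim : Tendsto (extendedCoeff ψ) atTop (𝓝 0) :=
    (tendsto_add_atTop_iff_nat 1).1 (tendsto_coeff_zero ψ)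
  have h1 := eq_joukowskiRoot_mul hz (N := N) (u := extendedCoeff ψ)
    (fun n hn => by rw [hrec, hb (n + 1) (by omega)]; simp) hlim
  have h2 := eq_orthoPoly_add_secondPoly (b := fun k => (P.b k : ℂ)) (u := extendedCoeff ψ) rfl hrec
  rw [h2 N, h2 (N + 1)] at h1
  have h3 : extendedCoeff ψ 1 = ψ 0 := rfl
  rw [h3] at h1
  linear_combination h1

theorem weylFun_den_ne_zero (ha : ∀ n, 1 ≤ n → P.a n = 1) (hb : ∀ n, N < n → P.b n = 0) {z : ℂ}
    (hz : 0 < z.im) : orthoPoly (fun k => (P.b k : ℂ)) z (N + 1) -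
      joukowskiRoot z * orthoPoly (fun k => (P.b k : ℂ)) z N ≠ 0 := by
  intro h
  obtain ⟨ψ, hψ⟩ := exists_resolvent_vector P.jacobiOperator_isSelfAdjoint deltaZero hz.ne'
  have h1 := coeff_zero_mul_den ha hb hz hψ
  rw [h, mul_zero] at h1
  have hw := wronskian_orthoPoly_secondPoly (fun k => (P.b k : ℂ)) z N
  have : (0 : ℂ) = -1 := by
    rw [← hw]
    linear_combination (-secondPoly (fun k => (P.b k : ℂ)) z N) * h +
      orthoPoly (fun k => (P.b k : ℂ)) z N * h1
  norm_num at this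

theorem inner_deltaZero_resolvent (ha : ∀ n, 1 ≤ n → P.a n = 1) (hb : ∀ n, N < n → P.b n = 0)
    {z : ℂ} (hz : 0 < z.im) {ψ : EllTwo} (hψ : P.jacobiOperator ψ = z • ψ + deltaZero) :
    ⟪deltaZero, ψ⟫_ℂ = weylFun P.b N z := by
  rw [inner_deltaZero, weylFun, eq_div_iff (weylFun_den_ne_zero ha hb hz)]
  exact coeff_zero_mul_den ha hb hz hψ

theorem continuousOn_weylFun (ha : ∀ n, 1 ≤ n → P.a n = 1) (hb : ∀ n, N < n → P.b n = 0) :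
    ContinuousOn (weylFun P.b N) {z | |z.re| < 2 ∧ 0 ≤ z.im} := by
  intro z hz
  refine ContinuousAt.continuousWithinAt ?_
  have h1 : ∀ n, ContinuousAt (fun z => orthoPoly (fun k => (P.b k : ℂ)) z n) z := fun n =>
    (continuous_recSol _ 0 1 n).continuousAt
  have h2 : ∀ n, ContinuousAt (fun z => secondPoly (fun k => (P.b k : ℂ)) z n) z := fun n =>
    (continuous_recSol _ (-1) 0 n).continuousAt
  have h3 := continuousAt_joukowskiRoot hz.1
  refine ContinuousAt.div ((h2 _).sub (h3.mul (h2 _))).neg ((h1 _).sub (h3.mul (h1 _))) ?_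
  rcases hz.2.eq_or_lt with h | h
  · have h4 : z = (z.re : ℂ) := Complex.ext rfl (by simpa using h.symm)
    rw [h4]
    exact weylFun_den_ofReal_ne_zero P.b N (abs_lt.1 hz.1)
  · exact weylFun_den_ne_zero ha hb h

theorem continuous_mul_of_tsupport_subset {f g : ℝ → ℝ} {s : Set ℝ} (hf : Continuous f)
    (hs : IsOpen s) (hg : ContinuousOn g s) (hfs : tsupport f ⊆ s) :
    Continuous fun x => f x * g x :=
  ContinuousOn.continuous_of_tsupport_subset (hf.continuousOn.mul hg) hs
    ((tsupport_mul_subset_left).trans hfs)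

/-- The spectral measure of a Jacobi matrix with off-diagonal entries `1` and eventually vanishing
diagonal, tested against functions supported in `(-2, 2)`. -/
theorem integral_measure_eq_integral_freeTailWeight (ha : ∀ n, 1 ≤ n → P.a n = 1)
    (hb : ∀ n, N < n → P.b n = 0) (f : C_c(ℝ, ℝ)) (hf : tsupport f ⊆ Ioo (-2) 2) :
    ∫ x, f x ∂P.measure = ∫ x, f x * freeTailWeight P.b N x := by
  have hlim := tendsto_integral_spectralMeasure P.jacobiOperator_isSelfAdjoint deltaZero f
    (m := fun x ε => (weylFun P.b N (x + ε * Complex.I)).im) fun x ε hε ψ hψ => by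
      rw [inner_deltaZero_resolvent ha hb (by simpa using hε) hψ]
  refine tendsto_nhds_unique hlim ?_
  set G : ℝ × ℝ → ℝ := fun q => Real.pi⁻¹ * (weylFun P.b N (q.1 + q.2 * Complex.I)).im with hG
  have hGc : ContinuousOn G (Ioo (-2) 2 ×ˢ Ici 0) := by
    refine continuousOn_const.mul (Complex.continuous_im.comp_continuousOn ?_)
    refine (continuousOn_weylFun ha hb).comp (by fun_prop) fun q hq => ?_
    refine ⟨?_, ?_⟩
    · simpa using abs_lt.2 hq.1
    · simpa using hq.2
  obtain ⟨B, hB⟩ := (f.hasCompactSupport.isCompact.prod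
    (isCompact_Icc (a := (0 : ℝ)) (b := 1))).exists_bound_of_continuousOn
    (hGc.mono (prod_mono hf fun y hy => hy.1))
  have hmain : Tendsto (fun ε : ℝ => ∫ x, f x * G (x, ε)) (𝓝[>] 0) (𝓝 (∫ x, f x * G (x, 0))) := by
    have hev : ∀ᶠ ε : ℝ in 𝓝[>] 0, 0 < ε ∧ ε < 1 :=
      Ioo_mem_nhdsGT (show (0 : ℝ) < 1 by norm_num)
    have hslice : ∀ ε : ℝ, 0 ≤ ε → ContinuousOn (fun x => G (x, ε)) (Ioo (-2) 2) := fun ε hε =>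
      hGc.comp (by fun_prop) fun x hx => ⟨hx, hε⟩
    refine tendsto_integral_filter_of_dominated_convergence (fun x => |f x| * B) ?_ ?_ ?_ ?_
    · filter_upwards [hev] with ε hε
      exact (continuous_mul_of_tsupport_subset f.continuous isOpen_Ioo (hslice ε hε.1.le)
        hf).aestronglyMeasurable
    · filter_upwards [hev] with ε hε
      refine Eventually.of_forall fun x => ?_
      rw [norm_mul, Real.norm_eq_abs]
      by_cases hx : x ∈ tsupport f
      · exact mul_le_mul_of_nonneg_left (hB (x, ε) ⟨hx, hε.1.le, hε.2.le⟩) (abs_nonneg _)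
      · rw [image_eq_zero_of_notMem_tsupport hx]
        simp
    · exact (f.continuous.integrable_of_hasCompactSupport f.hasCompactSupport).abs.mul_const B
    · refine Eventually.of_forall fun x => ?_
      by_cases hx : x ∈ tsupport f
      · refine Tendsto.const_mul _ ?_
        have h1 : ContinuousWithinAt (fun ε : ℝ => G (x, ε)) (Ici 0) 0 :=
          (hGc (x, 0) ⟨hf hx, le_refl (0 : ℝ)⟩).comp (by fun_prop) fun ε hε => ⟨hf hx, hε⟩
        exact h1.tendsto.mono_left (nhdsWithin_mono _ Ioi_subset_Ici_self)
      · simp [image_eq_zero_of_notMem_tsupport hx]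
  have e2 : ∫ x, f x * G (x, 0) = ∫ x, f x * freeTailWeight P.b N x := by
    congr 1
    funext x
    by_cases hx : x ∈ tsupport f
    · rw [← weylFun_ofReal_im P.b N (hf hx)]
      simp [hG]
    · simp [image_eq_zero_of_notMem_tsupport hx]
  rw [e2] at hmain
  exact hmain

end FreeTailMeasure

section Truncation

/-- The Jacobi parameters with the diagonal replaced by zero beyond the index `N`. -/
def JacobiParameters.truncate (P : JacobiParameters) (N : ℕ) : JacobiParameters where
  a := P.a
  b n := if n ≤ N then P.b n else 0
  a_pos := P.a_pos
  a_bounded := P.a_bounded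
  b_bounded := by
    obtain ⟨M, hM⟩ := P.b_bounded
    refine ⟨M, fun n hn => ?_⟩
    split_ifs
    · exact hM n hn
    · simpa using (abs_nonneg _).trans (hM n hn)

theorem recSol_congr {b c : ℕ → ℝ} (s t z : ℝ) {N : ℕ} (h : ∀ n, n ≤ N → b n = c n) (n : ℕ)
    (hn : n ≤ N + 1) : recSol b s t z n = recSol c s t z n := by
  induction n using Nat.twoStepInduction with
  | zero => rfl
  | one => rfl
  | more n h1 h2 =>
    rw [recSol_add_two, recSol_add_two, h1 (by omega), h2 (by omega), h _ (by omega)]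

theorem jostSq_truncate (P : JacobiParameters) (N : ℕ) (x : ℝ) :
    jostSq (P.truncate N).b N x = jostSq P.b N x := by
  have h : ∀ n, n ≤ N → (P.truncate N).b n = P.b n := fun n hn => if_pos hn
  simp only [jostSq, orthoPoly, recSol_congr 0 1 x h N (by omega),
    recSol_congr 0 1 x h (N + 1) le_rfl]

theorem norm_jacobiOperator_sub_truncate_le (P : JacobiParameters) (N : ℕ) {η : ℝ} (hη : 0 ≤ η)
    (h : ∀ n, N < n → |P.b n| ≤ η) :
    ‖(P.truncate N).jacobiOperator - P.jacobiOperator‖ ≤ η := by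
  refine ContinuousLinearMap.opNorm_le_bound _ hη fun u => ?_
  have hc : ∀ n, ‖((P.truncate N).jacobiOperator u - P.jacobiOperator u) n‖ ≤ η * ‖u n‖ := by
    intro n
    rw [lp.coeFn_sub, Pi.sub_apply, JacobiParameters.jacobiOperator_apply,
      JacobiParameters.jacobiOperator_apply]
    have e : (P.truncate N).jacobiFun u n - P.jacobiFun u n =
        (((P.truncate N).b (n + 1) - P.b (n + 1) : ℝ) : ℂ) * u n := by
      have hP : (P.truncate N).a = P.a := rfl
      cases n <;> simp only [JacobiParameters.jacobiFun, hP] <;> push_cast <;> ring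
    rw [e, norm_mul, Complex.norm_real]
    gcongr
    simp only [JacobiParameters.truncate]
    split_ifs with h1
    · simpa using hη
    · simpa using h (n + 1) (by omega)
  rw [sub_apply]
  refine lp.norm_le_of_forall_sum_le (by norm_num) (by positivity) fun s => ?_
  have hs := lp.sum_rpow_le_norm_rpow (p := 2) (by norm_num) u s
  simp only [ENNReal.toReal_ofNat, Real.rpow_ofNat] at hs ⊢
  calc ∑ i ∈ s, ‖((P.truncate N).jacobiOperator u - P.jacobiOperator u) i‖ ^ 2
      ≤ ∑ i ∈ s, (η * ‖u i‖) ^ 2 := Finset.sum_le_sum fun i _ => by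
        gcongr
        exact hc i
    _ = η ^ 2 * ∑ i ∈ s, ‖u i‖ ^ 2 := by simp only [mul_pow, Finset.mul_sum]
    _ ≤ (η * ‖u‖) ^ 2 := by
        rw [mul_pow]
        gcongr

theorem tendsto_jacobiOperator_truncate (P : JacobiParameters) (hlim : Tendsto P.b atTop (𝓝 0)) :
    Tendsto (fun N => (P.truncate N).jacobiOperator) atTop (𝓝 P.jacobiOperator) := by
  rw [tendsto_iff_norm_sub_tendsto_zero]
  rw [Metric.tendsto_atTop] at hlim ⊢
  intro ε hε
  obtain ⟨K, hK⟩ := hlim (ε / 2) (by positivity)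
  refine ⟨K, fun N hN => ?_⟩
  have := norm_jacobiOperator_sub_truncate_le P N (η := ε / 2) (by positivity) fun n hn => by
    simpa using (hK n (by omega)).le
  rw [dist_zero_right, norm_norm]
  linarith

theorem tendsto_integral_measure_truncate (P : JacobiParameters) (hlim : Tendsto P.b atTop (𝓝 0))
    (f : C_c(ℝ, ℝ)) :
    Tendsto (fun N => ∫ x, f x ∂(P.truncate N).measure) atTop (𝓝 (∫ x, f x ∂P.measure)) := by
  exact tendsto_integral_spectralMeasure_of_tendsto
    (fun N => (P.truncate N).jacobiOperator_isSelfAdjoint) P.jacobiOperator_isSelfAdjoint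
    (tendsto_jacobiOperator_truncate P hlim) deltaZero f

end Truncation

/-! ### Turán determinants and their limit -/

section Turan

/-- A diagonal `b 1 ≤ b 2 ≤ ⋯` of negative numbers that increases to zero. -/
structure IncreasesToZero (b : ℕ → ℝ) : Prop where
  le_succ : ∀ n, 1 ≤ n → b n ≤ b (n + 1)
  neg : ∀ n, 1 ≤ n → b n < 0
  tendsto : Tendsto b atTop (𝓝 0)

theorem IncreasesToZero.mono {b : ℕ → ℝ} (hb : IncreasesToZero b) {m n : ℕ} (hm : 1 ≤ m)
    (hmn : m ≤ n) : b m ≤ b n :=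
  Nat.le_induction (m := m) (P := fun k _ => b m ≤ b k) le_rfl
    (fun k hk ih => ih.trans (hb.le_succ k (hm.trans hk))) _ hmn

/-- The Turán determinant `p_n² - p_{n+1} p_{n-1}` of the orthonormal polynomials, written as a
quadratic form in `(p_n, p_{n-1})`. -/
def turan (b : ℕ → ℝ) (x : ℝ) (n : ℕ) : ℝ :=
  orthoPoly b x (n + 1) ^ 2 - (x - b (n + 1)) * orthoPoly b x (n + 1) * orthoPoly b x n +
    orthoPoly b x n ^ 2

variable {b : ℕ → ℝ} {x : ℝ} {n : ℕ}

/-- The Turán determinant is the same quadratic form in `(p_{n+1}, p_n)`. -/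
theorem turan_eq (b : ℕ → ℝ) (x : ℝ) (n : ℕ) :
    turan b x n = orthoPoly b x (n + 2) ^ 2 -
      (x - b (n + 1)) * orthoPoly b x (n + 2) * orthoPoly b x (n + 1) +
        orthoPoly b x (n + 1) ^ 2 := by
  rw [turan, orthoPoly_add_two]
  ring

theorem turan_succ (b : ℕ → ℝ) (x : ℝ) (n : ℕ) :
    turan b x (n + 1) = turan b x n +
      (b (n + 2) - b (n + 1)) * (orthoPoly b x (n + 2) * orthoPoly b x (n + 1)) := by
  rw [turan_eq b x n, turan]
  ring

theorem continuous_turan (b : ℕ → ℝ) (n : ℕ) : Continuous fun x => turan b x n := by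
  have h : ∀ n, Continuous fun x => orthoPoly b x n := continuous_recSol b 0 1
  exact (((h _).pow 2).sub (((continuous_id.sub continuous_const).mul (h _)).mul (h _))).add
    ((h _).pow 2)

theorem turan_pos (h : x - b (n + 1) ∈ Ioo (-2 : ℝ) 2) : 0 < turan b x n :=
  quadForm_pos h (orthoPoly_ne_zero_or b x n)

theorem two_sub_mul_le_turan (b : ℕ → ℝ) (x : ℝ) (n : ℕ) :
    (2 - (x - b (n + 1))) * (orthoPoly b x (n + 2) * orthoPoly b x (n + 1)) ≤ turan b x n := by
  rw [turan_eq]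
  nlinarith [sq_nonneg (orthoPoly b x (n + 2) - orthoPoly b x (n + 1))]

theorem two_add_mul_le_turan_succ (b : ℕ → ℝ) (x : ℝ) (n : ℕ) :
    (2 + (x - b (n + 2))) * -(orthoPoly b x (n + 2) * orthoPoly b x (n + 1)) ≤
      turan b x (n + 1) := by
  rw [turan]
  nlinarith [sq_nonneg (orthoPoly b x (n + 2) + orthoPoly b x (n + 1))]

/-- One step of growth is controlled by the distance of `x - b (n + 1)` to the upper edge `2`. -/
theorem turan_succ_le (hδ : b (n + 1) ≤ b (n + 2)) {D : ℝ} (hD : 0 < D)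
    (hD' : D ≤ 2 - (x - b (n + 1))) (hS : 0 ≤ turan b x n) :
    turan b x (n + 1) ≤ turan b x n * (1 + (b (n + 2) - b (n + 1)) / D) := by
  have h1 := two_sub_mul_le_turan b x n
  have h2 : orthoPoly b x (n + 2) * orthoPoly b x (n + 1) ≤ turan b x n / D := by
    rw [le_div_iff₀ hD]
    rcases le_total 0 (orthoPoly b x (n + 2) * orthoPoly b x (n + 1)) with h | h <;> nlinarith
  rw [turan_succ, mul_add, mul_one, mul_div_left_comm]
  gcongr

/-- One step of decay is controlled by the distance of `x - b (n + 2)` to the lower edge `-2`. -/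
theorem turan_le_succ (hδ : b (n + 1) ≤ b (n + 2)) {D : ℝ} (hD : 0 < D)
    (hD' : D ≤ 2 + (x - b (n + 2))) (hS : 0 ≤ turan b x (n + 1)) :
    turan b x n ≤ turan b x (n + 1) * (1 + (b (n + 2) - b (n + 1)) / D) := by
  have h1 := two_add_mul_le_turan_succ b x n
  have h2 : -(orthoPoly b x (n + 2) * orthoPoly b x (n + 1)) ≤ turan b x (n + 1) / D := by
    rw [le_div_iff₀ hD]
    rcases le_total 0 (orthoPoly b x (n + 2) * orthoPoly b x (n + 1)) with h | h <;> nlinarith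
  rw [mul_add, mul_one, mul_div_left_comm]
  have h3 := turan_succ b x n
  have h4 := mul_le_mul_of_nonneg_left h2 (sub_nonneg.2 hδ)
  linarith

variable (hb : IncreasesToZero b)
include hb

theorem turan_le_mul_exp {D : ℝ} (hD : 0 < D) {K : ℕ}
    (hKD : ∀ n, K ≤ n → D ≤ 2 - (x - b (n + 1))) (hS : ∀ n, K ≤ n → 0 ≤ turan b x n)
    (hn : K ≤ n) : turan b x n ≤ turan b x K * Real.exp (D⁻¹ * (b (n + 1) - b (K + 1))) := by
  induction n, hn using Nat.le_induction with
  | base => simp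
  | succ n hn ih =>
    have hδ := hb.le_succ (n + 1) (by omega)
    have h1 := turan_succ_le hδ hD (hKD n hn) (hS n hn)
    have h2 := Real.add_one_le_exp (D⁻¹ * (b (n + 2) - b (n + 1)))
    calc turan b x (n + 1) ≤ turan b x n * (1 + (b (n + 2) - b (n + 1)) / D) := h1
      _ ≤ (turan b x K * Real.exp (D⁻¹ * (b (n + 1) - b (K + 1)))) *
          Real.exp (D⁻¹ * (b (n + 2) - b (n + 1))) := by
        refine mul_le_mul ih ?_ ?_ ?_
        · rw [div_eq_inv_mul]
          linarith
        · have : 0 ≤ (b (n + 2) - b (n + 1)) / D := div_nonneg (sub_nonneg.2 hδ) hD.le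
          linarith
        · exact mul_nonneg (hS K le_rfl) (Real.exp_nonneg _)
      _ = _ := by
        rw [mul_assoc, ← Real.exp_add]
        congr 2
        ring

theorem turan_mul_exp_le {D : ℝ} (hD : 0 < D) {K : ℕ}
    (hKD : ∀ n, K ≤ n → D ≤ 2 + (x - b (n + 2))) (hS : ∀ n, K ≤ n → 0 ≤ turan b x n)
    (hn : K ≤ n) : turan b x K ≤ turan b x n * Real.exp (D⁻¹ * (b (n + 1) - b (K + 1))) := by
  induction n, hn using Nat.le_induction with
  | base => simp
  | succ n hn ih =>
    have hδ := hb.le_succ (n + 1) (by omega)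
    have h1 := turan_le_succ hδ hD (hKD n hn) (hS (n + 1) (by omega))
    have h2 := Real.add_one_le_exp (D⁻¹ * (b (n + 2) - b (n + 1)))
    calc turan b x K ≤ turan b x n * Real.exp (D⁻¹ * (b (n + 1) - b (K + 1))) := ih
      _ ≤ (turan b x (n + 1) * Real.exp (D⁻¹ * (b (n + 2) - b (n + 1)))) *
          Real.exp (D⁻¹ * (b (n + 1) - b (K + 1))) := by
        gcongr
        refine h1.trans (mul_le_mul_of_nonneg_left ?_ (hS (n + 1) (by omega)))
        rw [div_eq_inv_mul]
        linarith
      _ = _ := by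
        rw [mul_assoc, ← Real.exp_add]
        congr 2
        ring

/-- On a compact part of `(-2, 2)`, all but finitely many of the numbers `x - b n` lie in a compact
part of `(-2, 2)`. -/
theorem exists_index_sub_mem {η : ℝ} (hη : 0 < η) :
    ∃ K, ∀ n, K ≤ n → -(η / 2) ≤ b (n + 1) ∧ ∀ x, |x| ≤ 2 - η → |x - b (n + 1)| ≤ 2 - η / 2 := by
  obtain ⟨K, hK⟩ := (Metric.tendsto_atTop.1 hb.tendsto) (η / 2) (by positivity)
  refine ⟨K, fun n hn => ?_⟩
  have h1 := hK (n + 1) (by omega)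
  rw [Real.dist_0_eq_abs, abs_lt] at h1
  have h2 := hb.neg (n + 1) (by omega)
  refine ⟨h1.1.le, fun x hx => ?_⟩
  rw [abs_le] at hx ⊢
  constructor <;> linarith [hx.1, hx.2, h1.1]

/-- Uniform two-sided bounds for the Turán determinants on compact subsets of `(-2, 2)`. -/
theorem exists_turan_bounds {η : ℝ} (hη : 0 < η) : ∃ K : ℕ, ∃ m B : ℝ, 0 < m ∧
    (∀ n, K ≤ n → -(η / 2) ≤ b (n + 1)) ∧
    (∀ n, K ≤ n → ∀ x, |x| ≤ 2 - η → |x - b (n + 1)| ≤ 2 - η / 2) ∧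
    ∀ n, K ≤ n → ∀ x, |x| ≤ 2 - η → m ≤ turan b x n ∧ turan b x n ≤ B := by
  obtain ⟨K, hK⟩ := exists_index_sub_mem hb hη
  have hcomp : IsCompact {x : ℝ | |x| ≤ 2 - η} := by
    have : {x : ℝ | |x| ≤ 2 - η} = Icc (-(2 - η)) (2 - η) := by
      ext x
      simp [abs_le]
    rw [this]
    exact isCompact_Icc
  have hpos : ∀ n, K ≤ n → ∀ x, |x| ≤ 2 - η → 0 < turan b x n := fun n hn x hx => by
    have h := abs_le.1 ((hK n hn).2 x hx)
    exact turan_pos ⟨by linarith [h.1], by linarith [h.2]⟩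
  obtain ⟨B₀, hB₀⟩ := hcomp.exists_bound_of_continuousOn (continuous_turan b K).continuousOn
  obtain ⟨m₀, hm₀, hm₀'⟩ : ∃ m₀, 0 < m₀ ∧ ∀ x, |x| ≤ 2 - η → m₀ ≤ turan b x K := by
    rcases eq_empty_or_nonempty {x : ℝ | |x| ≤ 2 - η} with he | hne
    · exact ⟨1, one_pos, fun x hx => absurd (show x ∈ {x : ℝ | |x| ≤ 2 - η} from hx)
        (by rw [he]; exact notMem_empty x)⟩
    · obtain ⟨y, hy, hmin⟩ := hcomp.exists_isMinOn hne (continuous_turan b K).continuousOn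
      exact ⟨turan b y K, hpos K le_rfl y hy, fun x hx => hmin hx⟩
  have hD : 0 < η / 2 := by positivity
  set E := Real.exp ((η / 2)⁻¹ * (-b (K + 1))) with hE
  have hEpos : 0 < E := Real.exp_pos _
  have hexp : ∀ n, K ≤ n → Real.exp ((η / 2)⁻¹ * (b (n + 1) - b (K + 1))) ≤ E := fun n hn => by
    rw [hE]
    gcongr
    linarith [hb.neg (n + 1) (by omega)]
  refine ⟨K, m₀ / E, B₀ * E, by positivity, fun n hn => (hK n hn).1, fun n hn => (hK n hn).2,
    fun n hn x hx => ⟨?_, ?_⟩⟩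
  · rw [div_le_iff₀ hEpos]
    refine (hm₀' x hx).trans ((turan_mul_exp_le hb hD (fun n hn => ?_)
      (fun n hn => (hpos n hn x hx).le) hn).trans ?_)
    · have := (abs_le.1 ((hK (n + 1) (by omega)).2 x hx)).1
      linarith
    · exact mul_le_mul_of_nonneg_left (hexp n hn) (hpos n hn x hx).le
  · refine (turan_le_mul_exp hb hD (fun n hn => ?_) (fun n hn => (hpos n hn x hx).le) hn).trans ?_
    · have := (abs_le.1 ((hK n hn).2 x hx)).2
      linarith
    · have h1 := hB₀ x hx
      rw [Real.norm_eq_abs] at h1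
      exact mul_le_mul ((le_abs_self _).trans h1) (hexp n hn) (Real.exp_nonneg _)
        ((abs_nonneg _).trans h1)

omit hb in
theorem abs_mul_le_of_quadForm {c p q D : ℝ} (h : |c| ≤ 2 - D) :
    D * |p * q| ≤ p ^ 2 - c * p * q + q ^ 2 := by
  rw [abs_le] at h
  rcases abs_cases (p * q) with ⟨h1, h2⟩ | ⟨h1, h2⟩ <;> rw [h1]
  · nlinarith [sq_nonneg (p - q), h.2]
  · nlinarith [sq_nonneg (p + q), h.1]

end Turan

section TuranLimit

/-- The limit of the Turán determinants. -/
def turanLim (b : ℕ → ℝ) (x : ℝ) : ℝ := limUnder atTop (turan b x)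

variable {b : ℕ → ℝ} (hb : IncreasesToZero b)
include hb

/-- The Turán determinants converge uniformly on compact subsets of `(-2, 2)`; their total variation
is controlled by that of the diagonal. -/
theorem exists_abs_turanLim_sub_le {η : ℝ} (hη : 0 < η) : ∃ K : ℕ, ∃ C : ℝ, ∀ x, |x| ≤ 2 - η →
    Tendsto (turan b x) atTop (𝓝 (turanLim b x)) ∧
      ∀ n, K ≤ n → |turan b x n - turanLim b x| ≤ C * -b (n + 1) := by
  obtain ⟨K, m, B, hm, hb', hxb, hS⟩ := exists_turan_bounds hb hη
  set C := B / (η / 2) with hC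
  refine ⟨K, C, fun x hx => ?_⟩
  have hB : 0 ≤ B := hm.le.trans ((hS K le_rfl x hx).1.trans (hS K le_rfl x hx).2)
  have hC0 : 0 ≤ C := by positivity
  have hstep : ∀ n, K ≤ n → |turan b x (n + 1) - turan b x n| ≤ C * (b (n + 2) - b (n + 1)) := by
    intro n hn
    have hδ := hb.le_succ (n + 1) (by omega)
    have h1 : (η / 2) * |orthoPoly b x (n + 2) * orthoPoly b x (n + 1)| ≤ B := by
      refine le_trans ?_ (hS n hn x hx).2
      rw [turan_eq]
      exact abs_mul_le_of_quadForm (hxb n hn x hx)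
    rw [turan_succ, add_sub_cancel_left, abs_mul, abs_of_nonneg (sub_nonneg.2 hδ), mul_comm]
    gcongr
    rw [hC, le_div_iff₀ (by positivity)]
    linarith
  have hdiff : ∀ n, K ≤ n → ∀ k, |turan b x (n + k) - turan b x n| ≤
      C * (b (n + k + 1) - b (n + 1)) := by
    intro n hn k
    induction k with
    | zero => simp
    | succ k ih =>
      have h1 := hstep (n + k) (by omega)
      have h2 := abs_sub_le (turan b x (n + k + 1)) (turan b x (n + k)) (turan b x n)
      calc |turan b x (n + (k + 1)) - turan b x n| ≤ _ := h2
        _ ≤ C * (b (n + k + 2) - b (n + k + 1)) + C * (b (n + k + 1) - b (n + 1)) :=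
          add_le_add h1 ih
        _ = _ := by
          rw [show n + (k + 1) + 1 = n + k + 2 by ring]
          ring
  have hdiff' : ∀ n, K ≤ n → ∀ l, n ≤ l → |turan b x l - turan b x n| ≤ C * -b (n + 1) := by
    intro n hn l hl
    obtain ⟨k, rfl⟩ := Nat.exists_eq_add_of_le hl
    refine (hdiff n hn k).trans (mul_le_mul_of_nonneg_left ?_ hC0)
    linarith [hb.neg (n + k + 1) (by omega)]
  have hcauchy : CauchySeq (turan b x) := by
    rw [Metric.cauchySeq_iff']
    intro ε hε
    have hlim : Tendsto (fun n => C * -b (n + 1)) atTop (𝓝 (C * -0)) :=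
      (((tendsto_add_atTop_iff_nat 1).2 hb.tendsto).neg).const_mul C
    rw [neg_zero, mul_zero] at hlim
    obtain ⟨K', hK'⟩ := eventually_atTop.1 (hlim.eventually (gt_mem_nhds hε))
    refine ⟨max K K', fun l hl => ?_⟩
    rw [Real.dist_eq]
    exact (hdiff' _ (le_max_left _ _) l hl).trans_lt (hK' _ (le_max_right _ _))
  have hlim : Tendsto (turan b x) atTop (𝓝 (turanLim b x)) := hcauchy.tendsto_limUnder
  refine ⟨hlim, fun n hn => ?_⟩
  rw [abs_sub_comm]
  refine le_of_tendsto ((hlim.sub_const (turan b x n)).abs) ?_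
  filter_upwards [eventually_ge_atTop n] with l hl
  exact hdiff' n hn l hl

omit hb in
theorem exists_abs_le_two_sub {x : ℝ} (hx : x ∈ Ioo (-2 : ℝ) 2) : ∃ η > 0, |x| < 2 - η := by
  have h := abs_lt.2 hx
  exact ⟨(2 - |x|) / 2, by linarith, by linarith⟩

theorem tendsto_turan {x : ℝ} (hx : x ∈ Ioo (-2 : ℝ) 2) :
    Tendsto (turan b x) atTop (𝓝 (turanLim b x)) := by
  obtain ⟨η, hη, hxη⟩ := exists_abs_le_two_sub hx
  obtain ⟨K, C, h⟩ := exists_abs_turanLim_sub_le hb hη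
  exact (h x hxη.le).1

theorem turanLim_pos {x : ℝ} (hx : x ∈ Ioo (-2 : ℝ) 2) : 0 < turanLim b x := by
  obtain ⟨η, hη, hxη⟩ := exists_abs_le_two_sub hx
  obtain ⟨K, m, B, hm, -, -, hS⟩ := exists_turan_bounds hb hη
  refine hm.trans_le (ge_of_tendsto (tendsto_turan hb hx) ?_)
  filter_upwards [eventually_ge_atTop K] with n hn
  exact (hS n hn x hxη.le).1

theorem continuousOn_turanLim : ContinuousOn (turanLim b) (Ioo (-2) 2) := by
  intro x hx
  obtain ⟨η, hη, hxη⟩ := exists_abs_le_two_sub hx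
  obtain ⟨K, C, h⟩ := exists_abs_turanLim_sub_le hb hη
  have hunif : TendstoUniformlyOn (fun n x => turan b x n) (turanLim b) atTop
      {x | |x| ≤ 2 - η} := by
    rw [Metric.tendstoUniformlyOn_iff]
    intro ε hε
    have hlim : Tendsto (fun n => C * -b (n + 1)) atTop (𝓝 (C * -0)) :=
      (((tendsto_add_atTop_iff_nat 1).2 hb.tendsto).neg).const_mul C
    rw [neg_zero, mul_zero] at hlim
    filter_upwards [hlim.eventually (gt_mem_nhds hε), eventually_ge_atTop K] with n hn hnK y hy
    rw [dist_comm, Real.dist_eq]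
    exact ((h y hy).2 n hnK).trans_lt hn
  have hc := hunif.continuousOn (Eventually.of_forall fun n =>
    (continuous_turan b n).continuousOn).frequently
  have hnhds : {x : ℝ | |x| ≤ 2 - η} ∈ 𝓝 x := by
    filter_upwards [(continuous_abs.tendsto x).eventually (gt_mem_nhds hxη)] with y hy
    exact hy.le
  exact (hc.continuousAt hnhds).continuousWithinAt

end TuranLimit

/-! ### The density of the spectral measure -/

section LimitWeight

/-- The density of the spectral measure on `(-2, 2)`, in terms of the limit of the Turán
determinants. -/
def limitWeight (b : ℕ → ℝ) (x : ℝ) : ℝ := √(4 - x ^ 2) / (2 * Real.pi * turanLim b x)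

theorem sqrt_four_sub_sq_pos {x : ℝ} (hx : x ∈ Ioo (-2 : ℝ) 2) : 0 < √(4 - x ^ 2) :=
  Real.sqrt_pos.2 (by nlinarith [hx.1, hx.2])

theorem limitWeight_pos {b : ℕ → ℝ} (hb : IncreasesToZero b) {x : ℝ} (hx : x ∈ Ioo (-2 : ℝ) 2) :
    0 < limitWeight b x := by
  have h1 := sqrt_four_sub_sq_pos hx
  have h2 := turanLim_pos hb hx
  have h3 := Real.pi_pos
  unfold limitWeight
  positivity

theorem continuousOn_limitWeight {b : ℕ → ℝ} (hb : IncreasesToZero b) :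
    ContinuousOn (limitWeight b) (Ioo (-2) 2) := by
  refine ContinuousOn.div (by fun_prop) (continuousOn_const.mul (continuousOn_turanLim hb))
    fun x hx => ?_
  have h2 := turanLim_pos hb hx
  have h3 := Real.pi_pos
  positivity

theorem exists_abs_le_two_sub_of_isCompact {K : Set ℝ} (hK : IsCompact K) (h : K ⊆ Ioo (-2) 2) :
    ∃ η > 0, ∀ x ∈ K, |x| ≤ 2 - η := by
  rcases K.eq_empty_or_nonempty with rfl | hne
  · exact ⟨1, one_pos, fun x hx => absurd hx (notMem_empty x)⟩
  · obtain ⟨y, hy, hmax⟩ := hK.exists_isMaxOn hne continuous_abs.continuousOn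
    have := abs_lt.2 (h hy)
    exact ⟨2 - |y|, by linarith, fun x hx => by linarith [isMaxOn_iff.1 hmax x hx]⟩

theorem jostSq_eq_turan_add (b : ℕ → ℝ) (N : ℕ) (x : ℝ) :
    jostSq b N x = turan b x N - b (N + 1) * (orthoPoly b x (N + 1) * orthoPoly b x N) := by
  rw [jostSq, turan]
  ring

/-- The densities of the truncated problems converge boundedly on compact subsets of `(-2, 2)`. -/
theorem exists_freeTailWeight_bound {b : ℕ → ℝ} (hb : IncreasesToZero b) {η : ℝ} (hη : 0 < η) :
    ∃ K : ℕ, ∃ B : ℝ, ∀ x, |x| ≤ 2 - η → (∀ N, K ≤ N → |freeTailWeight b N x| ≤ B) ∧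
      Tendsto (fun N => freeTailWeight b N x) atTop (𝓝 (limitWeight b x)) := by
  obtain ⟨K, m, B, hm, hbK, hxb, hS⟩ := exists_turan_bounds hb hη
  have hpi := Real.pi_pos
  obtain ⟨K', hK'⟩ := (Metric.tendsto_atTop.1 hb.tendsto) (η / 4) (by positivity)
  have hprod : ∀ N, K ≤ N → ∀ x, |x| ≤ 2 - η →
      (η / 2) * |orthoPoly b x (N + 1) * orthoPoly b x N| ≤ turan b x N := fun N hN x hx =>
    abs_mul_le_of_quadForm (hxb N hN x hx)
  refine ⟨max K K', 2 / (2 * Real.pi * (m / 2)), fun x hx => ⟨fun N hN => ?_, ?_⟩⟩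
  · have h1 := hK' (N + 1) (by have := le_max_right K K'; omega)
    rw [Real.dist_0_eq_abs] at h1
    have hNK : K ≤ N := (le_max_left K K').trans hN
    have h2 := hprod N hNK x hx
    have h3 : |b (N + 1) * (orthoPoly b x (N + 1) * orthoPoly b x N)| ≤ turan b x N / 2 := by
      rw [abs_mul]
      have h4 : |b (N + 1)| * |orthoPoly b x (N + 1) * orthoPoly b x N| ≤
          η / 4 * |orthoPoly b x (N + 1) * orthoPoly b x N| := by gcongr
      linarith
    have h5 : m / 2 ≤ jostSq b N x := by
      rw [jostSq_eq_turan_add]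
      have h8 := le_abs_self (b (N + 1) * (orthoPoly b x (N + 1) * orthoPoly b x N))
      linarith [(hS N hNK x hx).1]
    have h6 : 0 < jostSq b N x := by linarith
    have h7 : √(4 - x ^ 2) ≤ 2 := by
      rw [Real.sqrt_le_left (by norm_num)]
      nlinarith [sq_nonneg x]
    rw [freeTailWeight, abs_of_nonneg (by positivity)]
    gcongr
  · have hx' : x ∈ Ioo (-2 : ℝ) 2 := abs_lt.1 (by linarith)
    have hlim : Tendsto (fun N => b (N + 1) * (orthoPoly b x (N + 1) * orthoPoly b x N)) atTop
        (𝓝 0) := by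
      refine squeeze_zero_norm' (a := fun N => |b (N + 1)| * (B / (η / 2))) ?_ ?_
      · filter_upwards [eventually_ge_atTop K] with N hN
        rw [Real.norm_eq_abs, abs_mul]
        gcongr
        rw [le_div_iff₀ (by positivity)]
        linarith [hprod N hN x hx, (hS N hN x hx).2]
      · have := (((tendsto_add_atTop_iff_nat 1).2 hb.tendsto).abs).mul_const (B / (η / 2))
        simpa using this
    have h2 : Tendsto (fun N => jostSq b N x) atTop (𝓝 (turanLim b x)) := by
      have := (tendsto_turan hb hx').sub hlim
      simpa only [jostSq_eq_turan_add, sub_zero] using this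
    refine (tendsto_const_nhds.div (h2.const_mul _) ?_)
    have := turanLim_pos hb hx'
    positivity

/-- The spectral measure has density `limitWeight` when tested against continuous functions
supported in `(-2, 2)`. -/
theorem integral_measure_eq_integral_limitWeight {P : JacobiParameters}
    (ha : ∀ n, 1 ≤ n → P.a n = 1) (hb : IncreasesToZero P.b) (f : C_c(ℝ, ℝ))
    (hf : tsupport f ⊆ Ioo (-2) 2) : ∫ x, f x ∂P.measure = ∫ x, f x * limitWeight P.b x := by
  refine tendsto_nhds_unique (tendsto_integral_measure_truncate P hb.tendsto f) ?_
  obtain ⟨η, hη, hfη⟩ := exists_abs_le_two_sub_of_isCompact f.hasCompactSupport.isCompact hf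
  obtain ⟨K, B, hB⟩ := exists_freeTailWeight_bound hb hη
  have e : ∀ N, ∫ x, f x ∂(P.truncate N).measure = ∫ x, f x * freeTailWeight P.b N x := by
    intro N
    rw [integral_measure_eq_integral_freeTailWeight (P := P.truncate N) (N := N) ha
      (fun n hn => if_neg (by omega)) f hf]
    simp only [freeTailWeight, jostSq_truncate]
  simp only [e]
  refine tendsto_integral_filter_of_dominated_convergence (fun x => |f x| * B) ?_ ?_ ?_ ?_
  · exact Eventually.of_forall fun N => (continuous_mul_of_tsupport_subset f.continuous isOpen_Ioo
      (continuousOn_freeTailWeight P.b N) hf).aestronglyMeasurable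
  · filter_upwards [eventually_ge_atTop K] with N hN
    refine Eventually.of_forall fun x => ?_
    rw [norm_mul, Real.norm_eq_abs]
    by_cases hx : x ∈ tsupport f
    · exact mul_le_mul_of_nonneg_left ((hB x (hfη x hx)).1 N hN) (abs_nonneg _)
    · simp [image_eq_zero_of_notMem_tsupport hx]
  · exact (f.continuous.integrable_of_hasCompactSupport f.hasCompactSupport).abs.mul_const B
  · refine Eventually.of_forall fun x => ?_
    by_cases hx : x ∈ tsupport f
    · exact (hB x (hfη x hx)).2.const_mul _
    · simp [image_eq_zero_of_notMem_tsupport hx]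

end LimitWeight

section Density

instance isFiniteMeasureOnCompacts_spectralMeasure {H : Type*} [NormedAddCommGroup H]
    [InnerProductSpace ℂ H] [CompleteSpace H] (T : H →L[ℂ] H) (hT : IsSelfAdjoint T) (v : H) :
    IsFiniteMeasureOnCompacts (spectralMeasure T hT v) := by
  unfold spectralMeasure RealRMK.rieszMeasure
  infer_instance

/-- Tent functions that increase to the indicator function of `(c, d)`. -/
def tentFun (c d : ℝ) (n : ℕ) (t : ℝ) : ℝ := min 1 (max 0 (min (n * (t - c) - 1) (n * (d - t) - 1)))

theorem continuous_tentFun (c d : ℝ) (n : ℕ) : Continuous (tentFun c d n) := by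
  unfold tentFun
  fun_prop

theorem tentFun_nonneg (c d : ℝ) (n : ℕ) (t : ℝ) : 0 ≤ tentFun c d n t :=
  le_min zero_le_one (le_max_left _ _)

theorem tentFun_eq_zero {c d : ℝ} {n : ℕ} {t : ℝ} (h : n * (t - c) - 1 ≤ 0 ∨ n * (d - t) - 1 ≤ 0) :
    tentFun c d n t = 0 := by
  have h1 : min (n * (t - c) - 1) (n * (d - t) - 1) ≤ 0 := min_le_iff.2 h
  rw [tentFun, max_eq_left h1]
  simp

theorem tentFun_eq_zero_of_notMem {c d : ℝ} (n : ℕ) {t : ℝ} (ht : t ∉ Ioo c d) :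
    tentFun c d n t = 0 := by
  refine tentFun_eq_zero ?_
  rw [mem_Ioo, not_and_or, not_lt, not_lt] at ht
  have hn : (0 : ℝ) ≤ n := n.cast_nonneg
  rcases ht with h | h
  · left; nlinarith
  · right; nlinarith

theorem tsupport_tentFun_subset (c d : ℝ) (n : ℕ) :
    tsupport (tentFun c d n) ⊆ Icc (c + (n : ℝ)⁻¹) (d - (n : ℝ)⁻¹) := by
  refine closure_minimal (fun t ht => ?_) isClosed_Icc
  by_contra hcon
  refine ht (tentFun_eq_zero ?_)
  rcases n.eq_zero_or_pos with rfl | hn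
  · left; simp
  · have hn' : (0 : ℝ) < n := by exact_mod_cast hn
    have h1 : (n : ℝ) * (n : ℝ)⁻¹ = 1 := mul_inv_cancel₀ hn'.ne'
    rw [mem_Icc, not_and_or, not_le, not_le] at hcon
    rcases hcon with h | h
    · left; nlinarith
    · right; nlinarith

theorem tsupport_tentFun_subset_Ioo (c d : ℝ) (n : ℕ) : tsupport (tentFun c d n) ⊆ Ioo c d := by
  rcases n.eq_zero_or_pos with rfl | hn
  · have : tentFun c d 0 = 0 := by
      funext t
      exact tentFun_eq_zero (Or.inl (by simp))
    rw [this]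
    simp
  · have h : (0 : ℝ) < (n : ℝ)⁻¹ := inv_pos.2 (by exact_mod_cast hn)
    exact (tsupport_tentFun_subset c d n).trans fun t ht => ⟨by linarith [ht.1], by linarith [ht.2]⟩

theorem monotone_tentFun (c d t : ℝ) : Monotone fun n => tentFun c d n t := by
  intro m n hmn
  by_cases ht : t ∈ Ioo c d
  · have h : (m : ℝ) ≤ n := by exact_mod_cast hmn
    have h1 := sub_pos.2 ht.1
    have h2 := sub_pos.2 ht.2
    change tentFun c d m t ≤ tentFun c d n t
    unfold tentFun
    gcongr
  · simp only [tentFun_eq_zero_of_notMem _ ht, le_refl]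

theorem tendsto_tentFun {c d t : ℝ} (ht : t ∈ Ioo c d) :
    Tendsto (fun n => tentFun c d n t) atTop (𝓝 1) := by
  have h1 := sub_pos.2 ht.1
  have h2 := sub_pos.2 ht.2
  have h3 : ∀ s : ℝ, 0 < s → ∀ᶠ n : ℕ in atTop, 2 ≤ n * s := fun s hs =>
    (tendsto_natCast_atTop_atTop.atTop_mul_const hs).eventually_ge_atTop 2
  refine tendsto_const_nhds.congr' ?_
  filter_upwards [h3 _ h1, h3 _ h2] with n hn1 hn2
  rw [tentFun, eq_comm, min_eq_left]
  exact le_max_of_le_right (le_min (by linarith) (by linarith))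

/-- A tent function as an element of `C_c(ℝ)`. -/
def tentCc (c d : ℝ) (n : ℕ) : C_c(ℝ, ℝ) where
  toFun := tentFun c d n
  continuous_toFun := continuous_tentFun c d n
  hasCompactSupport' := HasCompactSupport.of_support_subset_isCompact isCompact_Icc
    ((subset_tsupport _).trans (tsupport_tentFun_subset c d n))

theorem tendsto_lintegral_tentFun (ν : Measure ℝ) {g : ℝ → ENNReal} (c d : ℝ)
    (hg : AEMeasurable g ν) :
    Tendsto (fun n => ∫⁻ t, ENNReal.ofReal (tentFun c d n t) * g t ∂ν) atTop
      (𝓝 (∫⁻ t in Ioo c d, g t ∂ν)) := by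
  rw [← lintegral_indicator measurableSet_Ioo]
  refine lintegral_tendsto_of_tendsto_of_monotone (fun n => ?_) ?_ ?_
  · exact ((continuous_tentFun c d n).measurable.ennreal_ofReal.aemeasurable).mul hg
  · refine Eventually.of_forall fun t m n hmn => ?_
    dsimp only
    gcongr
    exact monotone_tentFun c d t hmn
  · refine Eventually.of_forall fun t => ?_
    by_cases ht : t ∈ Ioo c d
    · rw [indicator_of_mem ht]
      have h1 := (ENNReal.continuous_ofReal.tendsto _).comp (tendsto_tentFun ht)
      rw [ENNReal.ofReal_one] at h1
      have h2 := ENNReal.Tendsto.mul_const (b := g t) h1 (Or.inl one_ne_zero)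
      simpa [Function.comp_def] using h2
    · rw [indicator_of_notMem ht]
      simp [tentFun_eq_zero_of_notMem _ ht]

/-- A measure on the line that agrees with `w dx` on continuous functions supported in an open
interval has density `w` there. -/
theorem restrict_eq_withDensity {μ : Measure ℝ} [IsFiniteMeasureOnCompacts μ] {w : ℝ → ℝ}
    {A B : ℝ} (hw : ContinuousOn w (Ioo A B)) (hw0 : ∀ x ∈ Ioo A B, 0 ≤ w x)
    (h : ∀ f : C_c(ℝ, ℝ), tsupport f ⊆ Ioo A B → ∫ x, f x ∂μ = ∫ x, f x * w x) :
    μ.restrict (Ioo A B) =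
      (volume.restrict (Ioo A B)).withDensity fun x => ENNReal.ofReal (w x) := by
  have hwm : AEMeasurable (fun x => ENNReal.ofReal (w x)) (volume.restrict (Ioo A B)) :=
    (hw.aemeasurable measurableSet_Ioo).ennreal_ofReal
  refine Real.measure_ext_Ioo_rat fun p q => ?_
  rw [withDensity_apply _ measurableSet_Ioo, Measure.restrict_apply measurableSet_Ioo,
    Measure.restrict_restrict measurableSet_Ioo, Ioo_inter_Ioo]
  set c := (p : ℝ) ⊔ A
  set d := (q : ℝ) ⊓ B
  have hcd : Ioo c d ⊆ Ioo A B := Ioo_subset_Ioo le_sup_right inf_le_right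
  have h1 := tendsto_lintegral_tentFun μ c d (g := 1) aemeasurable_const
  have h2 := tendsto_lintegral_tentFun (volume.restrict (Ioo A B)) c d hwm
  rw [Measure.restrict_restrict measurableSet_Ioo, inter_eq_left.2 hcd] at h2
  simp only [Pi.one_apply, mul_one, lintegral_const, Measure.restrict_apply MeasurableSet.univ,
    univ_inter, one_mul] at h1
  refine tendsto_nhds_unique h1 (h2.congr fun n => ?_)
  have hsupp : tsupport (tentCc c d n) ⊆ Ioo A B := (tsupport_tentFun_subset_Ioo c d n).trans hcd
  have hint : Integrable (tentFun c d n) μ :=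
    (tentCc c d n).continuous.integrable_of_hasCompactSupport (tentCc c d n).hasCompactSupport
  have hcont : Continuous fun x => tentFun c d n x * w x :=
    continuous_mul_of_tsupport_subset (continuous_tentFun c d n) isOpen_Ioo hw hsupp
  have hint2 : Integrable fun x => tentFun c d n x * w x :=
    hcont.integrable_of_hasCompactSupport ((tentCc c d n).hasCompactSupport.mul_right)
  have hnn : ∀ x, 0 ≤ tentFun c d n x * w x := fun x => by
    by_cases hx : x ∈ Ioo A B
    · exact mul_nonneg (tentFun_nonneg c d n x) (hw0 x hx)
    · rw [tentFun_eq_zero_of_notMem n fun hx' => hx (hcd hx'), zero_mul]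
  have key := h (tentCc c d n) hsupp
  change ∫ x, tentFun c d n x ∂μ = ∫ x, tentFun c d n x * w x at key
  rw [← ofReal_integral_eq_lintegral_ofReal hint (Eventually.of_forall (tentFun_nonneg c d n)), key,
    ofReal_integral_eq_lintegral_ofReal hint2 (Eventually.of_forall hnn)]
  rw [← lintegral_indicator measurableSet_Ioo]
  congr 1
  funext x
  by_cases hx : x ∈ Ioo A B
  · rw [indicator_of_mem hx, ENNReal.ofReal_mul (tentFun_nonneg c d n x)]
  · rw [indicator_of_notMem hx, tentFun_eq_zero_of_notMem n fun hx' => hx (hcd hx')]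
    simp

theorem measure_restrict_eq_withDensity {P : JacobiParameters} (ha : ∀ n, 1 ≤ n → P.a n = 1)
    (hb : IncreasesToZero P.b) : P.measure.restrict (Ioo (-2) 2) =
      (volume.restrict (Ioo (-2) 2)).withDensity fun x => ENNReal.ofReal (limitWeight P.b x) := by
  have : IsFiniteMeasureOnCompacts P.measure := by
    unfold JacobiParameters.measure
    infer_instance
  exact restrict_eq_withDensity (continuousOn_limitWeight hb)
    (fun x hx => (limitWeight_pos hb hx).le)
    fun f hf => integral_measure_eq_integral_limitWeight ha hb f hf

end Density

/-! ### Estimates at the two edges -/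

section LowerEdge

variable {b : ℕ → ℝ} {x : ℝ}

/-- Near the lower edge the decay of the Turán determinants telescopes. -/
theorem turan_div_le_turanLim_div (hb : IncreasesToZero b) (hx : x ∈ Ioo (-2 : ℝ) 2) {K : ℕ}
    (hS : ∀ n, K ≤ n → 0 ≤ turan b x n) :
    turan b x K / (x + 2 - b (K + 1)) ≤ turanLim b x / (x + 2) := by
  have hpos : ∀ n, 0 < x + 2 - b (n + 1) := fun n => by
    linarith [hx.1, hb.neg (n + 1) (by omega)]
  have hstep : ∀ n, K ≤ n → turan b x K / (x + 2 - b (K + 1)) ≤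
      turan b x n / (x + 2 - b (n + 1)) := by
    intro n hn
    induction n, hn using Nat.le_induction with
    | base => exact le_rfl
    | succ n hn ih =>
      refine ih.trans ?_
      have h1 := turan_le_succ (hb.le_succ (n + 1) (by omega)) (hpos (n + 1))
        (show x + 2 - b (n + 2) ≤ 2 + (x - b (n + 2)) by linarith) (hS (n + 1) (by omega))
      rw [div_le_div_iff₀ (hpos n) (hpos (n + 1))]
      have h2 : 1 + (b (n + 2) - b (n + 1)) / (x + 2 - b (n + 2)) =
          (x + 2 - b (n + 1)) / (x + 2 - b (n + 2)) := by
        have := (hpos (n + 1)).ne'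
        field_simp
        ring
      rw [h2, ← mul_div_assoc, le_div_iff₀ (hpos (n + 1))] at h1
      exact h1
  have hlim : Tendsto (fun n => turan b x n / (x + 2 - b (n + 1))) atTop
      (𝓝 (turanLim b x / (x + 2 - 0))) :=
    (tendsto_turan hb hx).div (((tendsto_add_atTop_iff_nat 1).2 hb.tendsto).const_sub _)
      (by linarith [hx.1])
  rw [sub_zero] at hlim
  refine ge_of_tendsto hlim ?_
  filter_upwards [eventually_ge_atTop K] with n hn
  exact hstep n hn

theorem exists_limitWeight_bounds_lower_edge (hb : IncreasesToZero b) :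
    ∃ C₁ C₂ : ℝ, 0 < C₁ ∧ 0 < C₂ ∧
      ∀ x ∈ Ioc (-2 : ℝ) 0, C₁ * (x + 2) ≤ limitWeight b x ∧ limitWeight b x ≤ C₂ * (x + 2)⁻¹ := by
  obtain ⟨K, hK⟩ := (Metric.tendsto_atTop.1 hb.tendsto) 1 one_pos
  have hbK : ∀ n, K ≤ n → -1 ≤ b (n + 1) ∧ b (n + 1) < 0 := fun n hn => by
    have h := hK (n + 1) (by omega)
    rw [Real.dist_0_eq_abs, abs_lt] at h
    exact ⟨h.1.le, hb.neg _ (by omega)⟩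
  have hpos : ∀ n, K ≤ n → ∀ x ∈ Icc (-2 : ℝ) 0, 0 < turan b x n := fun n hn x hx =>
    turan_pos ⟨by linarith [hx.1, (hbK n hn).2], by linarith [hx.2, (hbK n hn).1]⟩
  have hne : (Icc (-2 : ℝ) 0).Nonempty := ⟨0, by norm_num, le_rfl⟩
  obtain ⟨y, hy, hmin⟩ := isCompact_Icc.exists_isMinOn hne (continuous_turan b K).continuousOn
  obtain ⟨y', hy', hmax⟩ := isCompact_Icc.exists_isMaxOn hne (continuous_turan b K).continuousOn
  set m := turan b y K with hm
  set M := turan b y' K with hM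
  have hm0 : 0 < m := hpos K le_rfl y hy
  have hM0 : 0 < M := hpos K le_rfl y' hy'
  have hpi := Real.pi_pos
  refine ⟨1 / (2 * Real.pi * (M * Real.exp 1)), 2 / (2 * Real.pi * (m / 3)), by positivity,
    by positivity, fun x hx => ?_⟩
  have hx2 : x ∈ Ioo (-2 : ℝ) 2 := ⟨hx.1, by linarith [hx.2]⟩
  have hxI : x ∈ Icc (-2 : ℝ) 0 := ⟨hx.1.le, hx.2⟩
  have hs : 0 < x + 2 := by linarith [hx.1]
  have hL := turanLim_pos hb hx2
  have hS : ∀ n, K ≤ n → 0 ≤ turan b x n := fun n hn => (hpos n hn x hxI).le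
  constructor
  · have h1 : turanLim b x ≤ M * Real.exp 1 := by
      refine le_of_tendsto (tendsto_turan hb hx2) ?_
      filter_upwards [eventually_ge_atTop K] with n hn
      refine (turan_le_mul_exp hb one_pos (fun n hn => ?_) hS hn).trans ?_
      · linarith [hx.2, (hbK n hn).1]
      · have h2 : turan b x K ≤ M := isMaxOn_iff.1 hmax x hxI
        have h3 : (1 : ℝ)⁻¹ * (b (n + 1) - b (K + 1)) ≤ 1 := by
          linarith [(hbK K le_rfl).1, (hbK n hn).2]
        gcongr
    have h2 : x + 2 ≤ √(4 - x ^ 2) := by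
      refine Real.le_sqrt_of_sq_le ?_
      nlinarith [hx.2]
    rw [limitWeight, one_div_mul_eq_div]
    gcongr
  · have h1 := turan_div_le_turanLim_div hb hx2 hS
    have h2 : m ≤ turan b x K := isMinOn_iff.1 hmin x hxI
    have h3 : m / 3 ≤ turan b x K / (x + 2 - b (K + 1)) := by
      have h4 : 0 < x + 2 - b (K + 1) := by linarith [(hbK K le_rfl).2]
      have h5 : x + 2 - b (K + 1) ≤ 3 := by linarith [(hbK K le_rfl).1, hx.2]
      have h6 := hS K le_rfl
      gcongr
    have h4 : m / 3 * (x + 2) ≤ turanLim b x := (le_div_iff₀ hs).1 (h3.trans h1)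
    have h5 : √(4 - x ^ 2) ≤ 2 := by
      rw [Real.sqrt_le_left (by norm_num)]
      nlinarith [sq_nonneg x]
    rw [limitWeight, ← div_eq_mul_inv, div_div, mul_assoc (2 * Real.pi)]
    gcongr

end LowerEdge

section ForbiddenRegion

variable {b γ : ℕ → ℝ} {x : ℝ} {N : ℕ}

theorem two_cosh_eq (t : ℝ) : 2 * Real.cosh t = Real.exp t + Real.exp (-t) := by
  rw [Real.cosh_eq]
  ring

/-- While `x - b n = 2 cosh γ_n` with decreasing `γ_n ≥ 0`, the polynomials grow at least like
`e^{γ_n}` per step. -/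
theorem exp_mul_orthoPoly_le (hγ : ∀ n, 1 ≤ n → n ≤ N → x - b n = 2 * Real.cosh (γ n))
    (hanti : ∀ n, 1 ≤ n → n + 1 ≤ N → γ (n + 1) ≤ γ n) {n : ℕ} (hn : 1 ≤ n) (hnN : n ≤ N) :
    0 < orthoPoly b x n ∧ Real.exp (γ n) * orthoPoly b x n ≤ orthoPoly b x (n + 1) := by
  induction n, hn using Nat.le_induction with
  | base =>
    rw [orthoPoly_add_two b x 0]
    simp only [zero_add, orthoPoly_one, orthoPoly_zero, mul_one, sub_zero]
    rw [hγ 1 le_rfl hnN, two_cosh_eq]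
    exact ⟨one_pos, by linarith [Real.exp_pos (-γ 1)]⟩
  | succ n hn ih =>
    obtain ⟨h1, h2⟩ := ih (by omega)
    have h3 : 0 < orthoPoly b x (n + 1) := (mul_pos (Real.exp_pos _) h1).trans_le h2
    refine ⟨h3, ?_⟩
    rw [orthoPoly_add_two, hγ (n + 1) (by omega) hnN, two_cosh_eq]
    have h4 : orthoPoly b x n ≤ Real.exp (-γ (n + 1)) * orthoPoly b x (n + 1) := by
      calc orthoPoly b x n = Real.exp (-γ n) * (Real.exp (γ n) * orthoPoly b x n) := by
            rw [← mul_assoc, ← Real.exp_add]; simp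
        _ ≤ Real.exp (-γ (n + 1)) * orthoPoly b x (n + 1) := by
            have := hanti n hn hnN
            gcongr
    linarith

theorem exp_sum_le_orthoPoly (hγ : ∀ n, 1 ≤ n → n ≤ N → x - b n = 2 * Real.cosh (γ n))
    (hanti : ∀ n, 1 ≤ n → n + 1 ≤ N → γ (n + 1) ≤ γ n) {n : ℕ} (hnN : n ≤ N) :
    Real.exp (∑ k ∈ Finset.range n, γ (k + 1)) ≤ orthoPoly b x (n + 1) := by
  induction n with
  | zero => simp
  | succ n ih =>
    rw [Finset.sum_range_succ, Real.exp_add, mul_comm]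
    refine le_trans ?_ (exp_mul_orthoPoly_le hγ hanti (by omega) hnN).2
    have := ih (by omega)
    gcongr

/-- Expansion of the continuant `orthoPoly b x (n + 2)` along its first row. -/
theorem orthoPoly_add_two_shift (b : ℕ → ℝ) (x : ℝ) (n : ℕ) :
    orthoPoly b x (n + 2) = (x - b 1) * orthoPoly (fun k => b (k + 1)) x (n + 1) -
      orthoPoly (fun k => b (k + 2)) x n := by
  induction n using Nat.twoStepInduction with
  | zero => simp [orthoPoly_add_two]
  | one =>
    simp [orthoPoly_add_two]
    ring
  | more n h1 h2 =>
    rw [orthoPoly_add_two b x (n + 2), h1, h2, orthoPoly_add_two (fun k => b (k + 1)) x (n + 1),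
      orthoPoly_add_two (fun k => b (k + 2)) x n]
    ring

/-- Removing the first row of the continuant gains at most a factor `e^{γ_1} (1 + 1 / (n + 1))`.
Working from this end makes the exponents increase along the recursion, so that the error terms do
not accumulate. -/
theorem orthoPoly_le_exp_mul_shift (n : ℕ) : ∀ {b γ : ℕ → ℝ},
    (∀ k, 1 ≤ k → k ≤ n + 1 → x - b k = 2 * Real.cosh (γ k)) →
    (∀ k, 1 ≤ k → k ≤ n + 1 → 0 ≤ γ k) →
    (∀ k, 1 ≤ k → k + 1 ≤ n + 1 → γ (k + 1) ≤ γ k) →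
    (n + 1) * orthoPoly b x (n + 2) ≤
      (n + 2) * (Real.exp (γ 1) * orthoPoly (fun k => b (k + 1)) x (n + 1)) := by
  induction n with
  | zero =>
    intro b γ h1 h2 h3
    rw [orthoPoly_add_two_shift, h1 1 le_rfl le_rfl, two_cosh_eq]
    have h4 : Real.exp (-γ 1) ≤ Real.exp (γ 1) := by
      have := h2 1 le_rfl le_rfl
      gcongr
      linarith
    simp
    linarith
  | succ n ih =>
    intro b γ h1 h2 h3
    have hp : 0 < orthoPoly (fun k => b (k + 1)) x (n + 2) := by
      obtain ⟨h5, h6⟩ := exp_mul_orthoPoly_le (N := n + 1) (b := fun k => b (k + 1))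
        (γ := fun k => γ (k + 1)) (x := x) (fun k hk hk' => h1 (k + 1) (by omega) (by omega))
        (fun k hk hk' => h3 (k + 1) (by omega) (by omega)) (n := n + 1) (by omega) le_rfl
      exact (mul_pos (Real.exp_pos _) h5).trans_le h6
    have h4 := ih (b := fun k => b (k + 1)) (γ := fun k => γ (k + 1))
      (fun k hk hk' => h1 (k + 1) (by omega) (by omega))
      (fun k hk hk' => h2 (k + 1) (by omega) (by omega))
      (fun k hk hk' => h3 (k + 1) (by omega) (by omega))
    rw [orthoPoly_add_two_shift, h1 1 le_rfl (by omega), two_cosh_eq]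
    set p := orthoPoly (fun k => b (k + 1)) x (n + 2)
    set q := orthoPoly (fun k => b (k + 2)) x (n + 1)
    simp only [Nat.reduceAdd] at h4
    change (n + 1 : ℝ) * p ≤ (n + 2) * (Real.exp (γ 2) * q) at h4
    have h5 : Real.exp (-γ 1) * ((n + 1) * p) ≤ (n + 2) * q := by
      calc Real.exp (-γ 1) * ((n + 1) * p) ≤ Real.exp (-γ 2) * ((n + 1) * p) := by
            have := h3 1 le_rfl (by omega)
            gcongr
        _ ≤ Real.exp (-γ 2) * ((n + 2) * (Real.exp (γ 2) * q)) := by gcongr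
        _ = (Real.exp (-γ 2) * Real.exp (γ 2)) * ((n + 2) * q) := by ring
        _ = (n + 2) * q := by rw [← Real.exp_add]; simp
    have h6 : Real.exp (-γ 1) * p ≤ Real.exp (γ 1) * p := by
      have := h2 1 le_rfl (by omega)
      gcongr
      linarith
    push_cast
    nlinarith

theorem orthoPoly_le_mul_exp_sum (n : ℕ) : ∀ {b γ : ℕ → ℝ},
    (∀ k, 1 ≤ k → k ≤ n → x - b k = 2 * Real.cosh (γ k)) →
    (∀ k, 1 ≤ k → k ≤ n → 0 ≤ γ k) →
    (∀ k, 1 ≤ k → k + 1 ≤ n → γ (k + 1) ≤ γ k) →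
    orthoPoly b x (n + 1) ≤ (n + 1) * Real.exp (∑ k ∈ Finset.range n, γ (k + 1)) := by
  induction n with
  | zero => intro b γ _ _ _; simp
  | succ n ih =>
    intro b γ h1 h2 h3
    have h4 := orthoPoly_le_exp_mul_shift n h1 h2 h3
    have h5 := ih (b := fun k => b (k + 1)) (γ := fun k => γ (k + 1))
      (fun k hk hk' => h1 (k + 1) (by omega) (by omega))
      (fun k hk hk' => h2 (k + 1) (by omega) (by omega))
      (fun k hk hk' => h3 (k + 1) (by omega) (by omega))
    rw [Finset.sum_range_succ', Real.exp_add]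
    have hn : (0 : ℝ) < n + 1 := by positivity
    refine le_of_mul_le_mul_left (h4.trans ?_) hn
    calc (n + 2 : ℝ) * (Real.exp (γ 1) * orthoPoly (fun k => b (k + 1)) x (n + 1))
        ≤ (n + 2) * (Real.exp (γ 1) *
          ((n + 1) * Real.exp (∑ k ∈ Finset.range n, γ (k + 1 + 1)))) := by gcongr
      _ = _ := by
        push_cast
        ring

end ForbiddenRegion

section UpperEdge

variable {b : ℕ → ℝ} {x : ℝ} {N : ℕ}

/-- Beyond the turning point the growth of the Turán determinants telescopes. -/
theorem turanLim_div_le_turan_div (hb : IncreasesToZero b) (hx : x ∈ Ioo (-2 : ℝ) 2) {K : ℕ}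
    (hK : x - b (K + 1) < 2) (hS : ∀ n, K ≤ n → 0 ≤ turan b x n) :
    turanLim b x / (2 - x) ≤ turan b x K / (2 - x + b (K + 1)) := by
  have hpos : ∀ n, K ≤ n → 0 < 2 - x + b (n + 1) := fun n hn => by
    linarith [hb.mono (show 1 ≤ K + 1 by omega) (show K + 1 ≤ n + 1 by omega)]
  have hstep : ∀ n, K ≤ n → turan b x n / (2 - x + b (n + 1)) ≤
      turan b x K / (2 - x + b (K + 1)) := by
    intro n hn
    induction n, hn using Nat.le_induction with
    | base => exact le_rfl
    | succ n hn ih =>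
      refine le_trans ?_ ih
      have h1 := turan_succ_le (hb.le_succ (n + 1) (by omega)) (hpos n hn)
        (show 2 - x + b (n + 1) ≤ 2 - (x - b (n + 1)) by linarith) (hS n hn)
      rw [div_le_div_iff₀ (hpos (n + 1) (by omega)) (hpos n hn)]
      have h2 : 1 + (b (n + 2) - b (n + 1)) / (2 - x + b (n + 1)) =
          (2 - x + b (n + 2)) / (2 - x + b (n + 1)) := by
        have := (hpos n hn).ne'
        field_simp
        ring
      rw [h2, ← mul_div_assoc, le_div_iff₀ (hpos n hn)] at h1
      exact h1
  have hlim : Tendsto (fun n => turan b x n / (2 - x + b (n + 1))) atTop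
      (𝓝 (turanLim b x / (2 - x + 0))) :=
    (tendsto_turan hb hx).div (((tendsto_add_atTop_iff_nat 1).2 hb.tendsto).const_add _)
      (by linarith [hx.2])
  rw [add_zero] at hlim
  refine le_of_tendsto hlim ?_
  filter_upwards [eventually_ge_atTop K] with n hn
  exact hstep n hn

/-- Two-sided bounds for the limit of the Turán determinants in terms of the polynomial at the
turning point. -/
theorem turanLim_bounds_upper_edge (hb : IncreasesToZero b) (hx : x ∈ Ioo (0 : ℝ) 2)
    (hN : ∀ n, N < n → x - b n < 2) (hΔ : b (N + 1) < b (N + 2))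
    (hp0 : 0 ≤ orthoPoly b x N) (hp : orthoPoly b x N ≤ orthoPoly b x (N + 1)) :
    (b (N + 2) - b (N + 1)) * orthoPoly b x (N + 1) ^ 2 ≤ 2 * Real.exp 1 * turanLim b x ∧
      turanLim b x * (b (N + 2) - b (N + 1)) ≤ 9 * (2 - x) * orthoPoly b x (N + 1) ^ 2 := by
  have hx2 : x ∈ Ioo (-2 : ℝ) 2 := ⟨by linarith [hx.1], hx.2⟩
  have hc : ∀ n, N < n → 0 < x - b n ∧ x - b n < 2 := fun n hn =>
    ⟨by linarith [hx.1, hb.neg n (by omega)], hN n hn⟩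
  have hS : ∀ n, N ≤ n → 0 < turan b x n := fun n hn =>
    turan_pos ⟨by linarith [(hc (n + 1) (by omega)).1], (hc (n + 1) (by omega)).2⟩
  have hL := turanLim_pos hb hx2
  have hd : 0 < 2 - x := by linarith [hx.2]
  have h1 := hc (N + 1) (by omega)
  have h2 := hc (N + 2) (by omega)
  set p := orthoPoly b x (N + 1)
  set q := orthoPoly b x N
  set r := orthoPoly b x (N + 2) with hr
  have hrec : r = (x - b (N + 1)) * p - q := orthoPoly_add_two b x N
  have hT : turan b x (N + 1) = r ^ 2 - (x - b (N + 2)) * r * p + p ^ 2 := rfl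
  have hp' : 0 ≤ p := hp0.trans hp
  constructor
  · have h3 : turan b x (N + 1) ≤ turanLim b x * Real.exp 1 := by
      refine ge_of_tendsto ((tendsto_turan hb hx2).mul_const _) ?_
      filter_upwards [eventually_ge_atTop (N + 1)] with n hn
      refine (turan_mul_exp_le hb two_pos (fun n hn => ?_)
        (fun n hn => (hS n (by omega)).le) hn).trans ?_
      · linarith [(hc (n + 2) (by omega)).1]
      · have h4 := (hS n (by omega)).le
        have h5 : (2 : ℝ)⁻¹ * (b (n + 1) - b (N + 1 + 1)) ≤ 1 := by
          linarith [hb.neg (n + 1) (by omega), hx.1, h2.2]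
        gcongr
    have h4 : (b (N + 2) - b (N + 1)) / 2 * p ^ 2 ≤ turan b x (N + 1) := by
      rw [hT]
      have h5 : r ^ 2 - (x - b (N + 2)) * r * p + p ^ 2 =
          (r - (x - b (N + 2)) / 2 * p) ^ 2 +
            (1 - (x - b (N + 2)) / 2) * (1 + (x - b (N + 2)) / 2) * p ^ 2 := by ring
      -- The first factor is at least `(b (N + 2) - b (N + 1)) / 2` because `x - b (N + 1) < 2`.
      have h6 : (b (N + 2) - b (N + 1)) / 2 ≤
          (1 - (x - b (N + 2)) / 2) * (1 + (x - b (N + 2)) / 2) := by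
        nlinarith
      rw [h5]
      have := mul_le_mul_of_nonneg_right h6 (sq_nonneg p)
      have := sq_nonneg (r - (x - b (N + 2)) / 2 * p)
      linarith
    linarith
  · have h3 := turanLim_div_le_turan_div hb hx2 (K := N + 1) h2.2 fun n hn => (hS n (by omega)).le
    have h4 : turan b x (N + 1) ≤ 9 * p ^ 2 := by
      have h5 : -p ≤ r := by rw [hrec]; nlinarith
      have h6 : r ≤ 2 * p := by rw [hrec]; nlinarith
      rw [hT]
      have h7 : r ^ 2 ≤ 4 * p ^ 2 := by nlinarith
      have h8 : -(r * p) ≤ p ^ 2 := by nlinarith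
      nlinarith
    have h5 : 0 < 2 - x + b (N + 1 + 1) := by linarith [h2.2]
    rw [div_le_div_iff₀ hd h5] at h3
    calc turanLim b x * (b (N + 2) - b (N + 1)) ≤ turanLim b x * (2 - x + b (N + 1 + 1)) := by
          gcongr
          linarith [h1.2]
      _ ≤ turan b x (N + 1) * (2 - x) := h3
      _ ≤ 9 * p ^ 2 * (2 - x) := by gcongr
      _ = _ := by ring

theorem gSum_eq_sum_range (b : ℕ → ℝ) (x : ℝ) :
    gSum b x = ∑ k ∈ Finset.range (turningPoint b x), gammaExp b (k + 1) x := by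
  rw [gSum, Finset.sum_bij (fun k _ => k - 1) (t := Finset.range (turningPoint b x))
    (g := fun k => gammaExp b (k + 1) x)]
  · intro k hk
    rw [Finset.mem_Icc] at hk
    rw [Finset.mem_range]
    omega
  · intro k hk l hl h
    rw [Finset.mem_Icc] at hk hl
    omega
  · intro k hk
    rw [Finset.mem_range] at hk
    exact ⟨k + 1, by rw [Finset.mem_Icc]; omega, by omega⟩
  · intro k hk
    rw [Finset.mem_Icc] at hk
    rw [Nat.sub_add_cancel hk.1]

/-- Up to the turning point the polynomials are comparable to `e^{g(x)}`, with a loss that is at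
most linear in the turning point. -/
theorem orthoPoly_turningPoint_bounds (hb : IncreasesToZero b) (hx : x < 2) :
    Real.exp (gSum b x) ≤ orthoPoly b x (turningPoint b x + 1) ∧
      orthoPoly b x (turningPoint b x + 1) ≤ (turningPoint b x + 1) * Real.exp (gSum b x) ∧
        0 ≤ orthoPoly b x (turningPoint b x) ∧
          orthoPoly b x (turningPoint b x) ≤ orthoPoly b x (turningPoint b x + 1) := by
  obtain ⟨hN, -⟩ := turningPoint_spec hb.le_succ hb.tendsto hx
  set N := turningPoint b x with hNdef
  have h1 : ∀ n, 1 ≤ n → n ≤ N → x - b n = 2 * Real.cosh (gammaExp b n x) := fun n hn hn' =>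
    (gammaExp_spec (hN n hn hn')).2
  have h2 : ∀ n, 1 ≤ n → n ≤ N → 0 ≤ gammaExp b n x := fun n hn hn' =>
    (gammaExp_spec (hN n hn hn')).1
  have h3 : ∀ n, 1 ≤ n → n + 1 ≤ N → gammaExp b (n + 1) x ≤ gammaExp b n x := by
    intro n hn hn'
    have h4 := hN n hn (by omega)
    have h5 := hN (n + 1) (by omega) hn'
    have h6 := hb.le_succ n hn
    unfold gammaExp
    rw [Real.arcosh_le_arcosh (by linarith) (by linarith)]
    linarith
  rw [gSum_eq_sum_range, ← hNdef]
  refine ⟨exp_sum_le_orthoPoly (γ := fun n => gammaExp b n x) h1 h3 le_rfl,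
    orthoPoly_le_mul_exp_sum (γ := fun n => gammaExp b n x) N h1 h2 h3, ?_⟩
  rcases N.eq_zero_or_pos with h0 | hpos
  · rw [h0]
    simp
  · obtain ⟨h4, h5⟩ := exp_mul_orthoPoly_le (γ := fun n => gammaExp b n x) h1 h3 hpos le_rfl
    refine ⟨h4.le, le_trans ?_ h5⟩
    exact le_mul_of_one_le_left h4.le (Real.one_le_exp (h2 N hpos le_rfl))

/-- The numerical part of the lower bound `Q ≥ g - h` at the upper edge: `w` is the weight,
`G = e^g`, `L` the limit of the Turán determinants, `p` the polynomial at the turning point,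
`d² = 2 - x`, `e² = 2 + x` and `E = e^h`. -/
theorem weight_mul_sq_le {w G L Δ d e m p E : ℝ} (hw : 0 ≤ w) (hG : 0 < G) (hΔ0 : 0 < Δ)
    (hd0 : 0 < d) (hΔd : Δ < d ^ 2) (hd2 : d ^ 2 < 2) (he2 : e ≤ 2) (hm1 : 1 ≤ m) (hp1 : G ≤ p)
    (hL : 0 < L) (hL1 : Δ * p ^ 2 ≤ 2 * Real.exp 1 * L) (hweq : w * (2 * Real.pi * L) = d * e)
    (hEΔ : E * Δ = 16 * m * d) : w * G ^ 2 ≤ E ^ 2 := by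
  have h1 : w * G ^ 2 * Δ ≤ 2 * d := by
    calc w * G ^ 2 * Δ = w * (Δ * G ^ 2) := by ring
      _ ≤ w * (Δ * p ^ 2) := by gcongr
      _ ≤ w * (2 * Real.exp 1 * L) := by gcongr
      _ ≤ w * (2 * Real.pi * L) := by
        have : Real.exp 1 ≤ Real.pi := by linarith [Real.exp_one_lt_d9, Real.pi_gt_three]
        gcongr
      _ = d * e := hweq
      _ ≤ 2 * d := by nlinarith
  have h2 : 2 * d * Δ ≤ (16 * m * d) ^ 2 := by
    have h3 : d < 2 := by nlinarith
    calc 2 * d * Δ ≤ 2 * d * d ^ 2 := by gcongr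
      _ ≤ 2 * 2 * d ^ 2 := by gcongr
      _ ≤ 256 * 1 ^ 2 * d ^ 2 := by nlinarith
      _ ≤ 256 * m ^ 2 * d ^ 2 := by gcongr
      _ = (16 * m * d) ^ 2 := by ring
  refine le_of_mul_le_mul_right ?_ (pow_pos hΔ0 2)
  calc w * G ^ 2 * Δ ^ 2 = w * G ^ 2 * Δ * Δ := by ring
    _ ≤ 2 * d * Δ := by gcongr
    _ ≤ (16 * m * d) ^ 2 := h2
    _ = E ^ 2 * Δ ^ 2 := by rw [← hEΔ]; ring

/-- The numerical part of the upper bound `Q ≤ g + h` at the upper edge, in the notation of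
`weight_mul_sq_le`. -/
theorem one_le_weight_mul_sq {w G L Δ d e m p E : ℝ} (hΔ0 : 0 < Δ)
    (hd0 : 0 < d) (hΔd : Δ < d ^ 2) (hde : d ≤ e) (hp0 : 0 ≤ p) (hp2 : p ≤ 2 * m * G)
    (hL : 0 < L) (hL2 : L * Δ ≤ 9 * d ^ 2 * p ^ 2) (hweq : w * (2 * Real.pi * L) = d * e)
    (hEΔ : E * Δ = 16 * m * d) : 1 ≤ w * G ^ 2 * E ^ 2 := by
  have hpi := Real.pi_pos
  have hpi4 := Real.pi_lt_d2
  have h2 : L * Δ ≤ 36 * d ^ 2 * m ^ 2 * G ^ 2 := by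
    calc L * Δ ≤ 9 * d ^ 2 * p ^ 2 := hL2
      _ ≤ 9 * d ^ 2 * (2 * m * G) ^ 2 := by gcongr
      _ = _ := by ring
  have h3 : Δ ≤ d * e := by nlinarith
  have hpos : 0 < 2 * Real.pi * L * Δ ^ 2 := by positivity
  refine le_of_mul_le_mul_right ?_ hpos
  calc 1 * (2 * Real.pi * L * Δ ^ 2) = 2 * Real.pi * (L * Δ) * Δ := by ring
    _ ≤ 2 * 3.15 * (36 * d ^ 2 * m ^ 2 * G ^ 2) * (d * e) := by gcongr
    _ = 226.8 * (d ^ 2 * m ^ 2 * G ^ 2 * (d * e)) := by ring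
    _ ≤ 256 * (d ^ 2 * m ^ 2 * G ^ 2 * (d * e)) := by
      have he0 : 0 < e := hd0.trans_le hde
      exact mul_le_mul_of_nonneg_right (by norm_num) (by positivity)
    _ = G ^ 2 * (16 * m * d) ^ 2 * (d * e) := by ring
    _ = G ^ 2 * (E * Δ) ^ 2 * (w * (2 * Real.pi * L)) := by rw [hEΔ, hweq]
    _ = w * G ^ 2 * E ^ 2 * (2 * Real.pi * L * Δ ^ 2) := by ring

/-- The error bound at the upper edge; the constant `16` is absolute. -/
theorem abs_log_limitWeight_le (hb : IncreasesToZero b) (hx : x ∈ Ioo (0 : ℝ) 2)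
    (hΔ : b (turningPoint b x + 1) < b (turningPoint b x + 2)) :
    |-(Real.log (limitWeight b x) / 2) - gSum b x| ≤ hBound 16 b x := by
  have hx2 : x ∈ Ioo (-2 : ℝ) 2 := ⟨by linarith [hx.1], hx.2⟩
  obtain ⟨-, hN⟩ := turningPoint_spec hb.le_succ hb.tendsto hx.2
  obtain ⟨hp1, hp2, hp3, hp4⟩ := orthoPoly_turningPoint_bounds hb hx.2
  obtain ⟨hL1, hL2⟩ := turanLim_bounds_upper_edge hb hx hN hΔ hp3 hp4
  have hb1 := hN (turningPoint b x + 1) (by omega)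
  have hb2 := hb.neg (turningPoint b x + 2) (by omega)
  have hw := limitWeight_pos hb hx2
  have hL := turanLim_pos hb hx2
  rw [hBound]
  set N := turningPoint b x
  set p := orthoPoly b x (N + 1)
  set Δ := b (N + 2) - b (N + 1) with hΔdef
  set G := Real.exp (gSum b x) with hG
  set m : ℝ := ((max N 1 : ℕ) : ℝ) with hm
  set d := √(2 - x) with hd
  set L := turanLim b x
  have hΔ0 : 0 < Δ := sub_pos.2 hΔ
  have hG0 : 0 < G := Real.exp_pos _
  have hm1 : 1 ≤ m := Nat.one_le_cast.2 (le_max_right N 1)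
  have hNm : (N : ℝ) + 1 ≤ 2 * m := by
    have : (N : ℝ) ≤ m := Nat.cast_le.2 (le_max_left N 1)
    linarith
  have hd0 : 0 < d := Real.sqrt_pos.2 (by linarith [hx.2])
  have hdsq : d ^ 2 = 2 - x := Real.sq_sqrt (by linarith [hx.2])
  have hΔd : Δ < d ^ 2 := by rw [hdsq]; linarith
  have hd2 : d ^ 2 < 2 := by rw [hdsq]; linarith [hx.1]
  have hpi := Real.pi_pos
  set e := √(2 + x) with he
  have he0 : 0 < e := Real.sqrt_pos.2 (by linarith [hx.1])
  have hesq : e ^ 2 = 2 + x := Real.sq_sqrt (by linarith [hx.1])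
  have hsqrt : √(4 - x ^ 2) = d * e := by
    rw [hd, he, ← Real.sqrt_mul (by linarith [hx.2])]
    congr 1
    ring
  have hweq : limitWeight b x * (2 * Real.pi * L) = d * e := by
    rw [limitWeight, hsqrt, div_mul_cancel₀ _ (by positivity)]
  set w := limitWeight b x
  set E := 16 * m * Δ⁻¹ * d with hE
  have hE0 : 0 < E := by positivity
  have hEΔ : E * Δ = 16 * m * d := by rw [hE]; field_simp
  have he2 : e ≤ 2 := by nlinarith [hx.2]
  have hde : d ≤ e := by nlinarith [hx.1]
  have hp2' : p ≤ 2 * m * G := hp2.trans (by gcongr)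
  have hL2' : L * Δ ≤ 9 * d ^ 2 * p ^ 2 := by rw [hdsq]; exact hL2
  have hup : w * G ^ 2 ≤ E ^ 2 :=
    weight_mul_sq_le hw.le hG0 hΔ0 hd0 hΔd hd2 he2 hm1 hp1 hL hL1 hweq hEΔ
  have hlow : 1 ≤ w * G ^ 2 * E ^ 2 :=
    one_le_weight_mul_sq hΔ0 hd0 hΔd hde (hp3.trans hp4) hp2' hL hL2' hweq hEΔ
  have hlogG : Real.log (G ^ 2) = 2 * gSum b x := by
    rw [Real.log_pow, hG, Real.log_exp]
    norm_num
  have h1 := Real.log_le_log (by positivity) hup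
  have h2 := Real.log_nonneg hlow
  rw [Real.log_mul (by positivity) (by positivity), hlogG, Real.log_pow] at h1
  rw [Real.log_mul (by positivity) (by positivity), Real.log_mul (by positivity) (by positivity),
    hlogG, Real.log_pow] at h2
  push_cast at h1 h2
  rw [abs_le]
  constructor <;> linarith

end UpperEdge

end

theorem theorem2p1 :
    -- `C` is the constant of the error bound, as a function of `sup |b n|` only
    ∃ C : ℝ → ℝ, (∀ M, 0 < C M) ∧
      ∀ P : JacobiParameters,
        (∀ n, 1 ≤ n → P.a n = 1) →
        (∀ n, 1 ≤ n → P.b n ≤ P.b (n + 1) ∧ P.b (n + 1) < 0) →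
        Tendsto P.b atTop (𝓝 0) →
        (P.measure.restrict (Ioo (-2) 2) ≪ volume) ∧
        ∃ w : ℝ → ℝ,
          P.measure.restrict (Ioo (-2) 2) =
            (volume.restrict (Ioo (-2) 2)).withDensity (fun x => ENNReal.ofReal (w x)) ∧
          ContinuousOn w (Ioo (-2) 2) ∧
          (∀ x ∈ Ioo (-2 : ℝ) 2, 0 < w x) ∧
          (∃ C₁ C₂ : ℝ, 0 < C₁ ∧ 0 < C₂ ∧
            ∀ x ∈ Ioc (-2 : ℝ) 0, C₁ * (x + 2) ≤ w x ∧ w x ≤ C₂ * (x + 2)⁻¹) ∧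
          ∃ Q : ℝ → ℝ, ∀ x ∈ Ioo (0 : ℝ) 2,
            w x = Real.exp (-2 * Q x) ∧
            (P.b (turningPoint P.b x + 1) < P.b (turningPoint P.b x + 2) →
              |Q x - gSum P.b x| ≤ hBound (C (⨆ n : ℕ, |P.b (n + 1)|)) P.b x) := by
  refine ⟨fun _ => 16, fun _ => by norm_num, fun P ha hmono hlim => ?_⟩
  have hb : IncreasesToZero P.b :=
    ⟨fun n hn => (hmono n hn).1, fun n hn => (hmono n hn).1.trans_lt (hmono n hn).2, hlim⟩
  have hμ := measure_restrict_eq_withDensity ha hb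
  refine ⟨?_, limitWeight P.b, hμ, continuousOn_limitWeight hb, fun x hx => limitWeight_pos hb hx,
    exists_limitWeight_bounds_lower_edge hb,
    fun x => -(Real.log (limitWeight P.b x) / 2), fun x hx => ⟨?_, abs_log_limitWeight_le hb hx⟩⟩
  · rw [hμ]
    exact (withDensity_absolutelyContinuous _ _).trans Measure.restrict_le_self.absolutelyContinuous
  · have hw := limitWeight_pos hb (x := x) ⟨by linarith [hx.1], hx.2⟩
    rw [show -2 * -(Real.log (limitWeight P.b x) / 2) = Real.log (limitWeight P.b x) by ring,
      Real.exp_log hw]
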